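/- Fix $k\ge 2$ and a $k$-fold monoidal category $\mathcal V$ in the sense of Balteanu, Fiedorowicz, Schwänzl and Vogt, with explicit associators. That is, $\mathcal V$ has bifunctors $\otimes_1,\dots,\otimes_k$, natural isomorphisms $\alpha^i:(A\otimes_iB)\otimes_iC\to A\otimes_i(B\otimes_iC)$ satisfying the pentagon, an object $I$ which is a strict two-sided unit for every $\otimes_i$, and natural transformations $\eta^{ij}:(A\otimes_jB)\otimes_i(C\otimes_jD)\to(A\otimes_iC)\otimes_j(B\otimes_iD)$ for $i<j$, subject to the internal and external unit conditions, the internal and external associativity conditions, and the hexagonal interchange condition for $i<j<l$. A $\mathcal V$-category is a small category $\mathcal A$ enriched over $(\mathcal V,\otimes_1,I,\alpha^1)$, with composition $M$ and identity elements $j_a:I\to\mathcal A(a,a)$. The product $\mathcal A\otimes\mathcal B$ of $\mathcal V$-categories has as objects the pairs of objects, hom-objects $\mathcal A(a,a')\otimes_2\mathcal B(b,b')$, and composition $(M\otimes_2M)\circ\eta^{12}$. The unit $\mathcal V$-category $\mathcal I$ has one object $0$, with $\mathcal I(0,0)=I$. A (small, strict) $\mathcal V$-2-category $U$ has a set of objects,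 $\mathcal V$-categories $U(A,B)$, and $\mathcal V$-functors $\mathcal M:U(B,C)\otimes U(A,B)\to U(A,C)$ and $\mathcal J_A:\mathcal I\to U(A,A)$ which satisfy the associativity axiom (relative to the associator of $\otimes$ given by $\alpha^2$) and the unit axioms as equalities of $\mathcal V$-functors. A $\mathcal V$-2-functor $T:U\to W$ is a map on objects with $\mathcal V$-functors $T_{AB}:U(A,B)\to W(TA,TB)$ compatible with $\mathcal M$ and $\mathcal J$. A $\mathcal V$-2-natural transformation $\theta:T\to S$ is a family of $\mathcal V$-functors $\theta_A:\mathcal I\to W(TA,SA)$ such that $$\mathcal M\circ(\theta_B\otimes T_{AB})=\mathcal M\circ(S_{AB}\otimes\theta_A):U(A,B)\to W(TA,SB)$$ under the identifications $\mathcal I\otimes U(A,B)=U(A,B)=U(A,B)\otimes\mathcal I$. A $\mathcal V$-modification $\mu:\theta\to\phi$ is a family of morphisms $\mu_A:I\to W(TA,SA)(\theta_A(0),\phi_A(0))$ such that for all objects $f,g$ of $U(A,B)$ $$\mathcal M\circ(\mu_B\otimes_2T_{AB,fg})=\mathcal M\circ(S_{AB,fg}\otimes_2\mu_A)$$ as morphisms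 out of $U(A,B)(f,g)=I\otimes_2U(A,B)(f,g)=U(A,B)(f,g)\otimes_2I$. **Theorem.** $\mathcal V$-2-categories, $\mathcal V$-2-functors, $\mathcal V$-2-natural transformations and $\mathcal V$-modifications are the 0-, 1-, 2- and 3-cells of a strict 3-category $\mathcal V$-2-Cat, that is, of a category enriched over the cartesian monoidal category 2-Cat of strict 2-categories and strict 2-functors, with the following compositions and identities (which are in particular well defined). 1. Along a $\mathcal V$-2-natural transformation: $(\nu\circ\mu)_A$ is $I=I\otimes_1I\xrightarrow{\nu_A\otimes_1\mu_A}\cdot\xrightarrow{M}\cdot$, and $(\mathbf 1_\alpha)_A=j_{\alpha_A(0)}$. 2. Along a $\mathcal V$-2-functor: $(\beta*\gamma)_A$ is $\mathcal I=\mathcal I\otimes\mathcal I\xrightarrow{\beta_A\otimes\gamma_A}\cdot\xrightarrow{\mathcal M}\cdot$, $(\nu*\mu)_A$ is $I=I\otimes_2I\xrightarrow{\nu_A\otimes_2\mu_A}\cdot\xrightarrow{\mathcal M}\cdot$, and $(\mathbf 1_T)_A=\mathcal J_{TA}$. 3. Along a $\mathcal V$-2-category: $\mathcal V$-2-functors compose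 by composing the object maps and the hom-$\mathcal V$-functors, with the evident identities. Let $F,F':U\to W$ and $G,G':W\to X$ be $\mathcal V$-2-functors. For $\mathcal V$-2-natural transformations $\alpha:F\to F'$ and $\gamma:G\to G'$, $$(\gamma\alpha)_A=\mathcal M\circ(\gamma_{F'A}\otimes G\alpha_A)=\mathcal M\circ(G'\alpha_A\otimes\gamma_{FA}):\mathcal I=\mathcal I\otimes\mathcal I\to X(GFA,G'F'A).$$ For $\mathcal V$-modifications $\mu:\alpha\to\alpha'$ and $\nu:\gamma\to\gamma'$, where $\alpha':F\to F'$ and $\gamma':G\to G'$, $$(\nu\mu)_A=\mathcal M\circ(\nu_{F'A}\otimes_2G\mu_A)=\mathcal M\circ(G'\mu_A\otimes_2\nu_{FA}):I=I\otimes_2I\to X(GFA,G'F'A)\bigl((\gamma\alpha)_A(0),(\gamma'\alpha')_A(0)\bigr).$$ -/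

import Mathlib

set_option linter.unusedSimpArgs false
set_option linter.unusedVariables false

open CategoryTheory

universe m w v u

section
open MonoidalCategory CartesianMonoidalCategory Limits

section
variable {V : Type u} [Category.{v} V] [CartesianMonoidalCategory V]

/-- The product of two categories enriched over a cartesian monoidal category:
pairs of objects, products of hom-objects, composition and identities componentwise. -/
@[reducible] def enrichedProd (C D : Type w) [EnrichedCategory V C] [EnrichedCategory V D] :
    EnrichedCategory V (C × D) where
  Hom p q := (p.1 ⟶[V] q.1) ⊗ (p.2 ⟶[V] q.2)
  id p := lift (eId V p.1) (eId V p.2)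
  comp p q r := lift ((fst _ _ ⊗ₘ fst _ _) ≫ eComp V p.1 q.1 r.1)
    ((snd _ _ ⊗ₘ snd _ _) ≫ eComp V p.2 q.2 r.2)
  id_comp p q := by
    apply CartesianMonoidalCategory.hom_ext
    · have h : (λ_ ((p.1 ⟶[V] q.1) ⊗ (p.2 ⟶[V] q.2))).inv ≫
        lift (eId V p.1) (eId V p.2) ▷ _ ≫ (fst _ _ ⊗ₘ fst _ _) =
          fst _ _ ≫ (λ_ (p.1 ⟶[V] q.1)).inv ≫ eId V p.1 ▷ _ := by
        apply CartesianMonoidalCategory.hom_ext <;> simp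
      rw [Category.assoc, Category.assoc, lift_fst, reassoc_of% h, e_id_comp]
      simp
    · have h : (λ_ ((p.1 ⟶[V] q.1) ⊗ (p.2 ⟶[V] q.2))).inv ≫
        lift (eId V p.1) (eId V p.2) ▷ _ ≫ (snd _ _ ⊗ₘ snd _ _) =
          snd _ _ ≫ (λ_ (p.2 ⟶[V] q.2)).inv ≫ eId V p.2 ▷ _ := by
        apply CartesianMonoidalCategory.hom_ext <;> simp
      rw [Category.assoc, Category.assoc, lift_snd, reassoc_of% h, e_id_comp]
      simp
  comp_id p q := by
    apply CartesianMonoidalCategory.hom_ext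
    · have h : (ρ_ ((p.1 ⟶[V] q.1) ⊗ (p.2 ⟶[V] q.2))).inv ≫
        _ ◁ lift (eId V q.1) (eId V q.2) ≫ (fst _ _ ⊗ₘ fst _ _) =
          fst _ _ ≫ (ρ_ (p.1 ⟶[V] q.1)).inv ≫ _ ◁ eId V q.1 := by
        apply CartesianMonoidalCategory.hom_ext <;> simp
      rw [Category.assoc, Category.assoc, lift_fst, reassoc_of% h, e_comp_id]
      simp
    · have h : (ρ_ ((p.1 ⟶[V] q.1) ⊗ (p.2 ⟶[V] q.2))).inv ≫
        _ ◁ lift (eId V q.1) (eId V q.2) ≫ (snd _ _ ⊗ₘ snd _ _) =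
          snd _ _ ≫ (ρ_ (p.2 ⟶[V] q.2)).inv ≫ _ ◁ eId V q.2 := by
        apply CartesianMonoidalCategory.hom_ext <;> simp
      rw [Category.assoc, Category.assoc, lift_snd, reassoc_of% h, e_comp_id]
      simp
  assoc p q r s := by
    apply CartesianMonoidalCategory.hom_ext
    · have h : (α_ _ _ _).inv ≫ (lift ((fst _ _ ⊗ₘ fst _ _) ≫ eComp V p.1 q.1 r.1)
          ((snd _ _ ⊗ₘ snd _ _) ≫ eComp V p.2 q.2 r.2)) ▷ _ ≫
            (fst _ _ ⊗ₘ fst (r.1 ⟶[V] s.1) (r.2 ⟶[V] s.2)) =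
          (fst _ _ ⊗ₘ (fst _ _ ⊗ₘ fst _ _)) ≫
            (α_ _ _ _).inv ≫ eComp V p.1 q.1 r.1 ▷ (r.1 ⟶[V] s.1) := by
        rw [associator_inv_naturality_assoc, ← MonoidalCategory.tensorHom_id,
          ← MonoidalCategory.tensorHom_id, MonoidalCategory.tensorHom_comp_tensorHom,
          MonoidalCategory.tensorHom_comp_tensorHom, lift_fst, Category.id_comp, Category.comp_id]
      have h' : (_ ◁ (lift ((fst _ _ ⊗ₘ fst _ _) ≫ eComp V q.1 r.1 s.1)
          ((snd _ _ ⊗ₘ snd _ _) ≫ eComp V q.2 r.2 s.2))) ≫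
            (fst (p.1 ⟶[V] q.1) (p.2 ⟶[V] q.2) ⊗ₘ fst _ _) =
          (fst _ _ ⊗ₘ (fst _ _ ⊗ₘ fst _ _)) ≫ (p.1 ⟶[V] q.1) ◁ eComp V q.1 r.1 s.1 := by
        rw [← MonoidalCategory.id_tensorHom, ← MonoidalCategory.id_tensorHom,
          MonoidalCategory.tensorHom_comp_tensorHom, MonoidalCategory.tensorHom_comp_tensorHom,
          lift_fst, Category.id_comp, Category.comp_id]
      simp only [Category.assoc, lift_fst]
      rw [reassoc_of% h, reassoc_of% h', e_assoc]
    · have h : (α_ _ _ _).inv ≫ (lift ((fst _ _ ⊗ₘ fst _ _) ≫ eComp V p.1 q.1 r.1)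
          ((snd _ _ ⊗ₘ snd _ _) ≫ eComp V p.2 q.2 r.2)) ▷ _ ≫
            (snd _ _ ⊗ₘ snd (r.1 ⟶[V] s.1) (r.2 ⟶[V] s.2)) =
          (snd _ _ ⊗ₘ (snd _ _ ⊗ₘ snd _ _)) ≫
            (α_ _ _ _).inv ≫ eComp V p.2 q.2 r.2 ▷ (r.2 ⟶[V] s.2) := by
        rw [associator_inv_naturality_assoc, ← MonoidalCategory.tensorHom_id,
          ← MonoidalCategory.tensorHom_id, MonoidalCategory.tensorHom_comp_tensorHom,
          MonoidalCategory.tensorHom_comp_tensorHom, lift_snd, Category.id_comp, Category.comp_id]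
      have h' : (_ ◁ (lift ((fst _ _ ⊗ₘ fst _ _) ≫ eComp V q.1 r.1 s.1)
          ((snd _ _ ⊗ₘ snd _ _) ≫ eComp V q.2 r.2 s.2))) ≫
            (snd (p.1 ⟶[V] q.1) (p.2 ⟶[V] q.2) ⊗ₘ snd _ _) =
          (snd _ _ ⊗ₘ (snd _ _ ⊗ₘ snd _ _)) ≫ (p.2 ⟶[V] q.2) ◁ eComp V q.2 r.2 s.2 := by
        rw [← MonoidalCategory.id_tensorHom, ← MonoidalCategory.id_tensorHom,
          MonoidalCategory.tensorHom_comp_tensorHom, MonoidalCategory.tensorHom_comp_tensorHom,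
          lift_snd, Category.id_comp, Category.comp_id]
      simp only [Category.assoc, lift_snd]
      rw [reassoc_of% h, reassoc_of% h', e_assoc]

end

/-- A (small, strict) 2-category: a category enriched over `Cat`. -/
structure TwoCat : Type (m + 1) where
  carrier : Type m
  [str : EnrichedCategory Cat.{m, m} carrier]

attribute [instance] TwoCat.str

namespace TwoCat

/-- The category 2-Cat: strict 2-categories and strict 2-functors, that is, `Cat`-enriched functors. -/
instance : Category TwoCat.{m} where
  Hom A B := EnrichedFunctor Cat.{m, m} A.carrier B.carrier
  id A := EnrichedFunctor.id _ _
  comp F G := EnrichedFunctor.comp _ F G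

/-- The action of a 2-functor on objects. -/
def obj {A B : TwoCat.{m}} (F : A ⟶ B) (a : A.carrier) : B.carrier :=
  EnrichedFunctor.obj F a

/-- The functor between hom-categories given by a 2-functor. -/
def map {A B : TwoCat.{m}} (F : A ⟶ B) (a a' : A.carrier) :
    (a ⟶[Cat.{m, m}] a') ⟶ (obj F a ⟶[Cat.{m, m}] obj F a') :=
  EnrichedFunctor.map F a a'

/-- The terminal 2-category. -/
def terminal : TwoCat.{m} where
  carrier := PUnit
  str :=
    { Hom := fun _ _ => 𝟙_ _
      id := fun _ => 𝟙 _
      comp := fun _ _ _ => toUnit _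
      id_comp := fun _ _ => toUnit_unique _ _
      comp_id := fun _ _ => toUnit_unique _ _
      assoc := fun _ _ _ _ => toUnit_unique _ _ }

/-- The product of two 2-categories. -/
def prod (A B : TwoCat.{m}) : TwoCat.{m} where
  carrier := A.carrier × B.carrier
  str := enrichedProd _ _

/-- The first projection. -/
def fstFunctor (A B : TwoCat.{m}) : prod A B ⟶ A where
  obj := Prod.fst
  map p q := fst (p.1 ⟶[Cat] q.1) (p.2 ⟶[Cat] q.2)
  map_id p := lift_fst _ _
  map_comp p q r := lift_fst _ _

/-- The second projection. -/
def sndFunctor (A B : TwoCat.{m}) : prod A B ⟶ B where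
  obj := Prod.snd
  map p q := snd (p.1 ⟶[Cat] q.1) (p.2 ⟶[Cat] q.2)
  map_id p := lift_snd _ _
  map_comp p q r := lift_snd _ _

/-- The 2-functor into a product with given components. -/
def pairing {S A B : TwoCat.{m}} (F : S ⟶ A) (G : S ⟶ B) : S ⟶ prod A B where
  obj s := (F.obj s, G.obj s)
  map s t := lift (F.map s t) (G.map s t)
  map_id s := by
    apply CartesianMonoidalCategory.hom_ext
    · exact (by simp : (eId Cat s ≫ lift (F.map s s) (G.map s s)) ≫ fst _ _ =
        eId Cat (F.obj s)).trans (lift_fst _ _).symm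
    · exact (by simp : (eId Cat s ≫ lift (F.map s s) (G.map s s)) ≫ snd _ _ =
        eId Cat (G.obj s)).trans (lift_snd _ _).symm
  map_comp s t u := by
    apply CartesianMonoidalCategory.hom_ext
    · have h : (lift (F.map s t) (G.map s t) ⊗ₘ lift (F.map t u) (G.map t u)) ≫
          (fst _ _ ⊗ₘ fst _ _) = F.map s t ⊗ₘ F.map t u := by
        rw [MonoidalCategory.tensorHom_comp_tensorHom, lift_fst, lift_fst]
      refine (Category.assoc _ _ _).trans ?_
      rw [lift_fst, F.map_comp]
      refine Eq.symm ((Category.assoc _ _ _).trans ?_)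
      refine (congrArg _ (lift_fst _ _)).trans ?_
      exact (reassoc_of% h) _
    · have h : (lift (F.map s t) (G.map s t) ⊗ₘ lift (F.map t u) (G.map t u)) ≫
          (snd _ _ ⊗ₘ snd _ _) = G.map s t ⊗ₘ G.map t u := by
        rw [MonoidalCategory.tensorHom_comp_tensorHom, lift_snd, lift_snd]
      refine (Category.assoc _ _ _).trans ?_
      rw [lift_snd, G.map_comp]
      refine Eq.symm ((Category.assoc _ _ _).trans ?_)
      refine (congrArg _ (lift_snd _ _)).trans ?_
      exact (reassoc_of% h) _

/-- `TwoCat.prod` is a product in 2-Cat. -/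
def isLimitProd (A B : TwoCat.{m}) :
   IsLimit (BinaryFan.mk (fstFunctor A B) (sndFunctor A B)) :=
  BinaryFan.isLimitMk (fun S => pairing S.fst S.snd)
    (fun S => EnrichedFunctor.ext _ (fun _ => rfl) (fun s t =>
      (Category.comp_id _).trans (lift_fst _ _)))
    (fun S => EnrichedFunctor.ext _ (fun _ => rfl) (fun s t =>
      (Category.comp_id _).trans (lift_snd _ _)))
    (fun S m h1 h2 => by
      have h3 : S.fst = m ≫ fstFunctor A B := h1.symm
      have h4 : S.snd = m ≫ sndFunctor A B := h2.symm
      rw [h3, h4]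
      refine EnrichedFunctor.ext _ (fun _ => rfl) (fun s t => (Category.comp_id _).trans ?_)
      exact CartesianMonoidalCategory.hom_ext _ _ (lift_fst _ _).symm (lift_snd _ _).symm)

/-- `TwoCat.terminal` is terminal in 2-Cat. -/
def isTerminal : IsTerminal terminal.{m} :=
  IsTerminal.ofUniqueHom (fun C =>
   { obj := fun _ => PUnit.unit
     map := fun _ _ => toUnit _
     map_id := fun _ => toUnit_unique _ _
     map_comp := fun _ _ _ => toUnit_unique _ _ })
   fun C F => EnrichedFunctor.ext _ (fun _ => rfl) fun _ _ => toUnit_unique _ _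

/-- 2-Cat with its cartesian monoidal structure. -/
instance : CartesianMonoidalCategory TwoCat.{m} :=
  .ofChosenFiniteProducts ⟨_, isTerminal⟩ fun A B => ⟨_, isLimitProd A B⟩

end TwoCat

end

/-- A `k`-fold monoidal category: `k` products `⊗_i` (bifunctors) with a common object `unit` which is
a strict two-sided unit for each of them, natural isomorphisms `assoc i` satisfying the pentagon,
and natural transformations `inter`, written `η^{ij}` for `i < j`, subject to the internal and
external unit conditions, the internal and external associativity conditions and the hexagonal
interchange condition. The strict unit makes an equality of objects into an identity morphism, which
is written `eqToHom`. -/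
class IteratedMonoidal (k : ℕ) (V : Type u) [Category.{v} V] where
  unit : V
  tensorObj : Fin k → V → V → V
  tensorHom : ∀ (i : Fin k) {A A' B B' : V}, (A ⟶ A') → (B ⟶ B') →
    (tensorObj i A B ⟶ tensorObj i A' B')
  tensorHom_id : ∀ (i : Fin k) (A B : V), tensorHom i (𝟙 A) (𝟙 B) = 𝟙 (tensorObj i A B)
  tensorHom_comp : ∀ (i : Fin k) {A A' A'' B B' B'' : V} (f : A ⟶ A') (f' : A' ⟶ A'')
    (g : B ⟶ B') (g' : B' ⟶ B''),
    tensorHom i (f ≫ f') (g ≫ g') = tensorHom i f g ≫ tensorHom i f' g'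
  /-- the associators `α^i` -/
  assoc : ∀ (i : Fin k) (A B C : V),
    tensorObj i (tensorObj i A B) C ≅ tensorObj i A (tensorObj i B C)
  assoc_naturality : ∀ (i : Fin k) {A A' B B' C C' : V} (f : A ⟶ A') (g : B ⟶ B') (h : C ⟶ C'),
    tensorHom i (tensorHom i f g) h ≫ (assoc i A' B' C').hom =
      (assoc i A B C).hom ≫ tensorHom i f (tensorHom i g h)
  pentagon : ∀ (i : Fin k) (A B C D : V),
    tensorHom i (assoc i A B C).hom (𝟙 D) ≫ (assoc i A (tensorObj i B C) D).hom ≫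
        tensorHom i (𝟙 A) (assoc i B C D).hom =
      (assoc i (tensorObj i A B) C D).hom ≫ (assoc i A B (tensorObj i C D)).hom
  /-- `unit` is a strict unit, on objects and on morphisms -/
  unit_tensorObj : ∀ (i : Fin k) (A : V), tensorObj i unit A = A
  tensorObj_unit : ∀ (i : Fin k) (A : V), tensorObj i A unit = A
  unit_tensorHom : ∀ (i : Fin k) {A B : V} (f : A ⟶ B),
    tensorHom i (𝟙 unit) f =
      eqToHom (unit_tensorObj i A) ≫ f ≫ eqToHom (unit_tensorObj i B).symm
  tensorHom_unit : ∀ (i : Fin k) {A B : V} (f : A ⟶ B),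
    tensorHom i f (𝟙 unit) =
      eqToHom (tensorObj_unit i A) ≫ f ≫ eqToHom (tensorObj_unit i B).symm
  /-- the interchange transformations `η^{ij}` -/
  inter : ∀ {i j : Fin k}, i < j → ∀ A B C D : V,
    tensorObj i (tensorObj j A B) (tensorObj j C D) ⟶
      tensorObj j (tensorObj i A C) (tensorObj i B D)
  inter_naturality : ∀ {i j : Fin k} (h : i < j) {A A' B B' C C' D D' : V}
    (a : A ⟶ A') (b : B ⟶ B') (c : C ⟶ C') (d : D ⟶ D'),
    tensorHom i (tensorHom j a b) (tensorHom j c d) ≫ inter h A' B' C' D' =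
      inter h A B C D ≫ tensorHom j (tensorHom i a c) (tensorHom i b d)
  /-- internal unit condition -/
  inter_unit_right : ∀ {i j : Fin k} (h : i < j) (A B : V),
    inter h A B unit unit =
      eqToHom (by simp only [unit_tensorObj, tensorObj_unit])
  /-- internal unit condition -/
  inter_unit_left : ∀ {i j : Fin k} (h : i < j) (A B : V),
    inter h unit unit A B =
      eqToHom (by simp only [unit_tensorObj])
  /-- external unit condition -/
  inter_ext_unit_right : ∀ {i j : Fin k} (h : i < j) (A B : V),
    inter h A unit B unit =
      eqToHom (by simp only [unit_tensorObj, tensorObj_unit])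
  /-- external unit condition -/
  inter_ext_unit_left : ∀ {i j : Fin k} (h : i < j) (A B : V),
    inter h unit A unit B =
      eqToHom (by simp only [unit_tensorObj])
  /-- internal associativity condition -/
  inter_assoc : ∀ {i j : Fin k} (h : i < j) (U U' W W' X X' : V),
    tensorHom i (inter h U U' W W') (𝟙 (tensorObj j X X')) ≫
        inter h (tensorObj i U W) (tensorObj i U' W') X X' ≫
        tensorHom j (assoc i U W X).hom (assoc i U' W' X').hom =
      (assoc i (tensorObj j U U') (tensorObj j W W') (tensorObj j X X')).hom ≫
        tensorHom i (𝟙 (tensorObj j U U')) (inter h W W' X X') ≫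
        inter h U U' (tensorObj i W X) (tensorObj i W' X')
  /-- external associativity condition -/
  inter_ext_assoc : ∀ {i j : Fin k} (h : i < j) (U U' W X X' Y : V),
    inter h (tensorObj j U U') W (tensorObj j X X') Y ≫
        tensorHom j (inter h U U' X X') (𝟙 (tensorObj i W Y)) ≫
        (assoc j (tensorObj i U X) (tensorObj i U' X') (tensorObj i W Y)).hom =
      tensorHom i (assoc j U U' W).hom (assoc j X X' Y).hom ≫
        inter h U (tensorObj j U' W) X (tensorObj j X' Y) ≫
        tensorHom j (𝟙 (tensorObj i U X)) (inter h U' W X' Y)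
  /-- giant hexagonal interchange diagram -/
  hexagon : ∀ {i j l : Fin k} (hij : i < j) (hjl : j < l) (A A' B B' C C' D D' : V),
    tensorHom i (inter hjl A A' B B') (inter hjl C C' D D') ≫
        inter (hij.trans hjl) (tensorObj j A B) (tensorObj j A' B')
          (tensorObj j C D) (tensorObj j C' D') ≫
        tensorHom l (inter hij A B C D) (inter hij A' B' C' D') =
      inter hij (tensorObj l A A') (tensorObj l B B') (tensorObj l C C') (tensorObj l D D') ≫
        tensorHom j (inter (hij.trans hjl) A A' C C') (inter (hij.trans hjl) B B' D D') ≫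
        inter hjl (tensorObj i A C) (tensorObj i A' C') (tensorObj i B D) (tensorObj i B' D')


namespace IteratedMonoidal

section
variable {k : ℕ} {V : Type u} [Category.{v} V] [IteratedMonoidal k V]

theorem tensorHom_eqToHom (i : Fin k) {A A' B B' : V} (p : A = A') (q : B = B') :
    tensorHom i (eqToHom p) (eqToHom q) = eqToHom (by rw [p, q]) := by
  subst p q
  simp [tensorHom_id]

theorem assoc_eqToHom (i : Fin k) {A A' B B' C C' : V} (p : A = A') (q : B = B') (r : C = C') :
    (assoc i A B C).hom = eqToHom (by rw [p, q, r]) ≫ (assoc i A' B' C').hom ≫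
      eqToHom (by rw [p, q, r]) := by
  subst p q r
  simp

theorem tensorHom_eqToHom_left (i : Fin k) {A B B' : V} (p : A = unit k) (f : B ⟶ B') :
    tensorHom i (eqToHom p) f = eqToHom (by rw [p, unit_tensorObj]) ≫ f ≫
      eqToHom (by rw [unit_tensorObj]) := by
  subst p
  rw [eqToHom_refl, unit_tensorHom]

theorem tensorHom_eqToHom_right (i : Fin k) {A B B' : V} (p : A = unit k) (f : B ⟶ B') :
    tensorHom i f (eqToHom p) = eqToHom (by rw [p, tensorObj_unit]) ≫ f ≫
      eqToHom (by rw [tensorObj_unit]) := by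
  subst p
  rw [eqToHom_refl, tensorHom_unit]

/-- The component of an associator at three copies of the unit is an identity. -/
theorem assoc_unit (i : Fin k) :
    (assoc i (unit k : V) (unit k) (unit k)).hom =
      eqToHom (by rw [unit_tensorObj]) := by
  have hu : tensorObj i (unit k : V) (unit k) = unit k := unit_tensorObj i _
  have h := pentagon i (unit k : V) (unit k) (unit k) (unit k)
  rw [unit_tensorHom, tensorHom_unit, assoc_eqToHom i rfl hu rfl, assoc_eqToHom i hu rfl rfl,
    assoc_eqToHom i rfl rfl hu] at h
  simp only [Category.assoc, eqToHom_trans_assoc, cancel_epi] at h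
  have e1 : tensorObj i (unit k : V) (tensorObj i (unit k) (unit k)) =
      tensorObj i (unit k) (tensorObj i (unit k) (tensorObj i (unit k) (unit k))) := by
    simp only [unit_tensorObj]
  have e2 : tensorObj i (unit k : V) (tensorObj i (unit k) (unit k)) =
      tensorObj i (tensorObj i (unit k) (unit k)) (unit k) := by
    simp only [unit_tensorObj]
  rw [← cancel_mono (eqToHom e1), ← cancel_epi (eqToHom e2)]
  simpa using h

end

section
variable (k : ℕ) [hk : Fact (2 ≤ k)]
/-- The index of the first product `⊗₁`. -/
def one : Fin k := ⟨0, by have := hk.out; omega⟩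
/-- The index of the second product `⊗₂`. -/
def two : Fin k := ⟨1, by have := hk.out; omega⟩
theorem one_lt_two : one k < two k := by simp [one, two]
end

end IteratedMonoidal

section
open IteratedMonoidal

/-- A (small) `V`-category: a category enriched over `(V, ⊗₁, I)`. -/
structure VCat (k : ℕ) [Fact (2 ≤ k)] (V : Type u) [Category.{v} V] [IteratedMonoidal k V] where
  Obj : Type w
  hom : Obj → Obj → V
  /-- composition `M : A(b,c) ⊗₁ A(a,b) ⟶ A(a,c)` -/
  comp : ∀ a b c : Obj, tensorObj (one k) (hom b c) (hom a b) ⟶ hom a c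
  /-- identity elements `j : I ⟶ A(a,a)` -/
  id : ∀ a : Obj, (unit k : V) ⟶ hom a a
  assoc : ∀ a b c d : Obj,
    tensorHom (one k) (comp b c d) (𝟙 (hom a b)) ≫ comp a b d =
      (IteratedMonoidal.assoc (one k) (hom c d) (hom b c) (hom a b)).hom ≫
        tensorHom (one k) (𝟙 (hom c d)) (comp a b c) ≫ comp a c d
  id_comp : ∀ a b : Obj,
    tensorHom (one k) (id b) (𝟙 (hom a b)) ≫ comp a b b =
      eqToHom (unit_tensorObj (one k) (hom a b))
  comp_id : ∀ a b : Obj,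
    tensorHom (one k) (𝟙 (hom a b)) (id a) ≫ comp a a b =
      eqToHom (tensorObj_unit (one k) (hom a b))

variable {k : ℕ} [Fact (2 ≤ k)] {V : Type u} [Category.{v} V] [IteratedMonoidal k V]

/-- A `V`-functor. -/
@[ext]
structure VFunctor (A B : VCat.{w} k V) where
  obj : A.Obj → B.Obj
  map : ∀ a a' : A.Obj, A.hom a a' ⟶ B.hom (obj a) (obj a')
  map_comp : ∀ a b c : A.Obj, A.comp a b c ≫ map a c =
    tensorHom (one k) (map b c) (map a b) ≫ B.comp (obj a) (obj b) (obj c)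
  map_id : ∀ a : A.Obj, A.id a ≫ map a a = B.id (obj a)

namespace VFunctor

/-- The identity `V`-functor. -/
def id (A : VCat.{w} k V) : VFunctor A A where
  obj a := a
  map _ _ := 𝟙 _
  map_comp a b c := by simp [tensorHom_id]
  map_id a := by simp

/-- Composition of `V`-functors, in diagrammatic order: first `F`, then `G`. -/
def comp {A B C : VCat.{w} k V} (F : VFunctor A B) (G : VFunctor B C) : VFunctor A C where
  obj a := G.obj (F.obj a)
  map a a' := F.map a a' ≫ G.map (F.obj a) (F.obj a')
  map_comp a b c := by
    rw [reassoc_of% (F.map_comp a b c), G.map_comp, tensorHom_comp, Category.assoc]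
  map_id a := by rw [reassoc_of% (F.map_id a), G.map_id]

end VFunctor

namespace VCat

/-- The unit `V`-category: one object, with hom-object the unit `I` of `V`. -/
def unitCat (k : ℕ) [Fact (2 ≤ k)] (V : Type u) [Category.{v} V] [IteratedMonoidal k V] :
    VCat.{w} k V where
  Obj := PUnit
  hom _ _ := unit k
  comp _ _ _ := eqToHom (unit_tensorObj (one k) _)
  id _ := 𝟙 _
  assoc _ _ _ _ := by
    simp [assoc_unit, unit_tensorHom, tensorHom_unit]
  id_comp _ _ := by simp [tensorHom_id]
  comp_id _ _ := by simp [tensorHom_id]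

/-- The product `A ⊗₁⁽¹⁾ B` of `V`-categories: pairs of objects, hom-objects
`A(a,a') ⊗₂ B(b,b')`, and composition defined through `η^{12}`. -/
def tensor (A B : VCat.{w} k V) : VCat.{w} k V where
  Obj := A.Obj × B.Obj
  hom p q := tensorObj (two k) (A.hom p.1 q.1) (B.hom p.2 q.2)
  comp p q r :=
    inter (one_lt_two k) (A.hom q.1 r.1) (B.hom q.2 r.2) (A.hom p.1 q.1) (B.hom p.2 q.2) ≫
      tensorHom (two k) (A.comp p.1 q.1 r.1) (B.comp p.2 q.2 r.2)
  id p := eqToHom (unit_tensorObj (two k) _).symm ≫ tensorHom (two k) (A.id p.1) (B.id p.2)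
  assoc p q r s := by
    have e1 : tensorHom (one k)
        (inter (one_lt_two k) (A.hom r.1 s.1) (B.hom r.2 s.2) (A.hom q.1 r.1) (B.hom q.2 r.2) ≫
          tensorHom (two k) (A.comp q.1 r.1 s.1) (B.comp q.2 r.2 s.2))
        (𝟙 (tensorObj (two k) (A.hom p.1 q.1) (B.hom p.2 q.2))) =
        tensorHom (one k) (inter (one_lt_two k) (A.hom r.1 s.1) (B.hom r.2 s.2)
          (A.hom q.1 r.1) (B.hom q.2 r.2)) (𝟙 _) ≫
        tensorHom (one k) (tensorHom (two k) (A.comp q.1 r.1 s.1) (B.comp q.2 r.2 s.2))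
          (tensorHom (two k) (𝟙 (A.hom p.1 q.1)) (𝟙 (B.hom p.2 q.2))) := by
      rw [← tensorHom_comp, tensorHom_id, Category.comp_id]
    have e2 : tensorHom (one k) (𝟙 (tensorObj (two k) (A.hom r.1 s.1) (B.hom r.2 s.2)))
        (inter (one_lt_two k) (A.hom q.1 r.1) (B.hom q.2 r.2) (A.hom p.1 q.1) (B.hom p.2 q.2) ≫
          tensorHom (two k) (A.comp p.1 q.1 r.1) (B.comp p.2 q.2 r.2)) =
        tensorHom (one k) (𝟙 _) (inter (one_lt_two k) (A.hom q.1 r.1) (B.hom q.2 r.2)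
          (A.hom p.1 q.1) (B.hom p.2 q.2)) ≫
        tensorHom (one k) (tensorHom (two k) (𝟙 (A.hom r.1 s.1)) (𝟙 (B.hom r.2 s.2)))
          (tensorHom (two k) (A.comp p.1 q.1 r.1) (B.comp p.2 q.2 r.2)) := by
      rw [← tensorHom_comp, tensorHom_id, Category.comp_id]
    rw [e1, e2]
    simp only [Category.assoc]
    rw [reassoc_of% (inter_naturality (one_lt_two k) (A.comp q.1 r.1 s.1) (B.comp q.2 r.2 s.2)
        (𝟙 (A.hom p.1 q.1)) (𝟙 (B.hom p.2 q.2))),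
      reassoc_of% (inter_naturality (one_lt_two k) (𝟙 (A.hom r.1 s.1)) (𝟙 (B.hom r.2 s.2))
        (A.comp p.1 q.1 r.1) (B.comp p.2 q.2 r.2)),
      ← tensorHom_comp, ← tensorHom_comp, A.assoc, B.assoc, tensorHom_comp,
      reassoc_of% (inter_assoc (one_lt_two k))]
  id_comp p q := by
    have e1 : tensorHom (one k)
        (eqToHom (unit_tensorObj (two k) _).symm ≫ tensorHom (two k) (A.id q.1) (B.id q.2))
        (𝟙 (tensorObj (two k) (A.hom p.1 q.1) (B.hom p.2 q.2))) =
        tensorHom (one k) (eqToHom (unit_tensorObj (two k) _).symm) (eqToHom rfl) ≫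
        tensorHom (one k) (tensorHom (two k) (A.id q.1) (B.id q.2))
          (tensorHom (two k) (𝟙 (A.hom p.1 q.1)) (𝟙 (B.hom p.2 q.2))) := by
      rw [← tensorHom_comp, tensorHom_id, eqToHom_refl, Category.comp_id]
    rw [e1, Category.assoc,
      reassoc_of% (inter_naturality (one_lt_two k) (A.id q.1) (B.id q.2)
        (𝟙 (A.hom p.1 q.1)) (𝟙 (B.hom p.2 q.2))),
      ← tensorHom_comp, A.id_comp, B.id_comp, inter_unit_left]
    simp only [tensorHom_eqToHom, eqToHom_trans]
  comp_id p q := by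
    have e1 : tensorHom (one k) (𝟙 (tensorObj (two k) (A.hom p.1 q.1) (B.hom p.2 q.2)))
        (eqToHom (unit_tensorObj (two k) _).symm ≫ tensorHom (two k) (A.id p.1) (B.id p.2)) =
        tensorHom (one k) (eqToHom rfl) (eqToHom (unit_tensorObj (two k) _).symm) ≫
        tensorHom (one k) (tensorHom (two k) (𝟙 (A.hom p.1 q.1)) (𝟙 (B.hom p.2 q.2)))
          (tensorHom (two k) (A.id p.1) (B.id p.2)) := by
      rw [← tensorHom_comp, tensorHom_id, eqToHom_refl, Category.comp_id]
    rw [e1, Category.assoc,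
      reassoc_of% (inter_naturality (one_lt_two k) (𝟙 (A.hom p.1 q.1)) (𝟙 (B.hom p.2 q.2))
        (A.id p.1) (B.id p.2)),
      ← tensorHom_comp, A.comp_id, B.comp_id, inter_unit_right]
    simp only [tensorHom_eqToHom, eqToHom_trans]

end VCat

namespace VFunctor

/-- The product of two `V`-functors. -/
def tensor {A A' B B' : VCat.{w} k V} (F : VFunctor A A') (G : VFunctor B B') :
    VFunctor (A.tensor B) (A'.tensor B') where
  obj p := (F.obj p.1, G.obj p.2)
  map p q := tensorHom (two k) (F.map p.1 q.1) (G.map p.2 q.2)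
  map_comp p q r := by
    simp only [VCat.tensor, Category.assoc]
    rw [reassoc_of% (inter_naturality (one_lt_two k)), ← tensorHom_comp, ← tensorHom_comp,
      F.map_comp, G.map_comp]
  map_id p := by
    simp only [VCat.tensor, Category.assoc]
    rw [← tensorHom_comp, F.map_id, G.map_id]

/-- The associator of the product of `V`-categories, given on hom-objects by `α²`. -/
def associator (A B C : VCat.{w} k V) :
    VFunctor ((A.tensor B).tensor C) (A.tensor (B.tensor C)) where
  obj p := (p.1.1, (p.1.2, p.2))
  map p q := (assoc (two k) (A.hom p.1.1 q.1.1) (B.hom p.1.2 q.1.2) (C.hom p.2 q.2)).hom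
  map_comp p q r := by
    simp only [VCat.tensor, Category.assoc]
    have e1 : ∀ {X Y Z X' Y' : V} (f : X ⟶ Y) (g : Y ⟶ Z) (h : X' ⟶ Y'),
        tensorHom (two k) (f ≫ g) h = tensorHom (two k) f (𝟙 _) ≫ tensorHom (two k) g h := by
      intros
      rw [← tensorHom_comp, Category.id_comp]
    have e2 : ∀ {X Y Z X' Y' : V} (f : X ⟶ Y) (g : Y ⟶ Z) (h : X' ⟶ Y'),
        tensorHom (two k) h (f ≫ g) = tensorHom (two k) (𝟙 _) f ≫ tensorHom (two k) h g := by
      intros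
      rw [← tensorHom_comp, Category.id_comp]
    rw [e1, e2, Category.assoc, assoc_naturality, reassoc_of% (inter_ext_assoc (one_lt_two k))]
  map_id p := by
    simp only [VCat.tensor, Category.assoc]
    have e1 : tensorHom (two k) (eqToHom (unit_tensorObj (two k) _).symm ≫
        tensorHom (two k) (A.id p.1.1) (B.id p.1.2)) (C.id p.2) =
        tensorHom (two k) (eqToHom (unit_tensorObj (two k) _).symm) (eqToHom rfl) ≫
        tensorHom (two k) (tensorHom (two k) (A.id p.1.1) (B.id p.1.2)) (C.id p.2) := by
      rw [← tensorHom_comp, eqToHom_refl, Category.id_comp]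
    have e2 : tensorHom (two k) (A.id p.1.1) (eqToHom (unit_tensorObj (two k) _).symm ≫
        tensorHom (two k) (B.id p.1.2) (C.id p.2)) =
        tensorHom (two k) (eqToHom rfl) (eqToHom (unit_tensorObj (two k) _).symm) ≫
        tensorHom (two k) (A.id p.1.1) (tensorHom (two k) (B.id p.1.2) (C.id p.2)) := by
      rw [← tensorHom_comp, eqToHom_refl, Category.id_comp]
    rw [e1, e2, Category.assoc, assoc_naturality, assoc_unit]
    simp only [tensorHom_eqToHom, eqToHom_trans_assoc]

/-- The identification of `I ⊗ A` with `A`. -/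
def leftUnitor (A : VCat.{w} k V) : VFunctor ((VCat.unitCat k V).tensor A) A where
  obj p := p.2
  map p q := eqToHom (unit_tensorObj (two k) _)
  map_comp p q r := by
    simp only [VCat.tensor, VCat.unitCat, Category.assoc, tensorHom_eqToHom_left,
      tensorHom_eqToHom_right, inter_ext_unit_left, inter_ext_unit_right, tensorHom_eqToHom,
      eqToHom_trans, eqToHom_trans_assoc, eqToHom_refl, Category.comp_id, Category.id_comp]
  map_id p := by
    simp [VCat.tensor, VCat.unitCat, unit_tensorHom]

/-- The identification of `A ⊗ I` with `A`. -/
def rightUnitor (A : VCat.{w} k V) : VFunctor (A.tensor (VCat.unitCat k V)) A where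
  obj p := p.1
  map p q := eqToHom (tensorObj_unit (two k) _)
  map_comp p q r := by
    simp only [VCat.tensor, VCat.unitCat, Category.assoc, tensorHom_eqToHom_left,
      tensorHom_eqToHom_right, inter_ext_unit_left, inter_ext_unit_right, tensorHom_eqToHom,
      eqToHom_trans, eqToHom_trans_assoc, eqToHom_refl, Category.comp_id, Category.id_comp]
  map_id p := by
    simp [VCat.tensor, VCat.unitCat, tensorHom_unit]

/-- The identification of `A` with `I ⊗ A`. -/
def leftUnitorInv (A : VCat.{w} k V) : VFunctor A ((VCat.unitCat k V).tensor A) where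
  obj a := (PUnit.unit, a)
  map p q := eqToHom (unit_tensorObj (two k) _).symm
  map_comp p q r := by
    simp only [VCat.tensor, VCat.unitCat, Category.assoc, tensorHom_eqToHom_left,
      tensorHom_eqToHom_right, inter_ext_unit_left, inter_ext_unit_right, tensorHom_eqToHom,
      eqToHom_trans, eqToHom_trans_assoc, eqToHom_refl, Category.comp_id, Category.id_comp]
  map_id p := by
    simp [VCat.tensor, VCat.unitCat, unit_tensorHom]

/-- The identification of `A` with `A ⊗ I`. -/
def rightUnitorInv (A : VCat.{w} k V) : VFunctor A (A.tensor (VCat.unitCat k V)) where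
  obj a := (a, PUnit.unit)
  map p q := eqToHom (tensorObj_unit (two k) _).symm
  map_comp p q r := by
    simp only [VCat.tensor, VCat.unitCat, Category.assoc, tensorHom_eqToHom_left,
      tensorHom_eqToHom_right, inter_ext_unit_left, inter_ext_unit_right, tensorHom_eqToHom,
      eqToHom_trans, eqToHom_trans_assoc, eqToHom_refl, Category.comp_id, Category.id_comp]
  map_id p := by
    simp [VCat.tensor, VCat.unitCat, tensorHom_unit]

end VFunctor

/-- A (small, strict) `V`-2-category: `V`-categories `U(a,b)`, composition `V`-functors
`U(b,c) ⊗ U(a,b) → U(a,c)` and unit `V`-functors `I → U(a,a)`, subject to the associativity and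
unit axioms, which are equalities of `V`-functors. -/
structure V2Cat (k : ℕ) [Fact (2 ≤ k)] (V : Type u) [Category.{v} V] [IteratedMonoidal k V] where
  Obj : Type w
  hom : Obj → Obj → VCat.{w} k V
  comp : ∀ a b c : Obj, VFunctor ((hom b c).tensor (hom a b)) (hom a c)
  id : ∀ a : Obj, VFunctor (VCat.unitCat k V) (hom a a)
  assoc : ∀ a b c d : Obj,
    (VFunctor.tensor (comp b c d) (VFunctor.id (hom a b))).comp (comp a b d) =
      (VFunctor.associator (hom c d) (hom b c) (hom a b)).comp
        ((VFunctor.tensor (VFunctor.id (hom c d)) (comp a b c)).comp (comp a c d))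
  id_comp : ∀ a b : Obj,
    (VFunctor.tensor (id b) (VFunctor.id (hom a b))).comp (comp a b b) =
      VFunctor.leftUnitor (hom a b)
  comp_id : ∀ a b : Obj,
    (VFunctor.tensor (VFunctor.id (hom a b)) (id a)).comp (comp a a b) =
      VFunctor.rightUnitor (hom a b)

/-- A `V`-2-functor. -/
structure V2Functor (U W : V2Cat.{w} k V) where
  obj : U.Obj → W.Obj
  map : ∀ a b : U.Obj, VFunctor (U.hom a b) (W.hom (obj a) (obj b))
  map_comp : ∀ a b c : U.Obj,
    (U.comp a b c).comp (map a c) =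
      (VFunctor.tensor (map b c) (map a b)).comp (W.comp (obj a) (obj b) (obj c))
  map_id : ∀ a : U.Obj, (U.id a).comp (map a a) = W.id (obj a)

theorem VFunctor.comp_assoc {A B C D : VCat.{w} k V} (F : VFunctor A B) (G : VFunctor B C)
    (H : VFunctor C D) : (F.comp G).comp H = F.comp (G.comp H) := by
  simp only [VFunctor.comp, Category.assoc]

theorem VFunctor.tensor_comp {A A' A'' B B' B'' : VCat.{w} k V} (F : VFunctor A A')
    (F' : VFunctor A' A'') (G : VFunctor B B') (G' : VFunctor B' B'') :
    VFunctor.tensor (F.comp F') (G.comp G') = (F.tensor G).comp (F'.tensor G') := by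
  simp only [VFunctor.comp, VFunctor.tensor, tensorHom_comp]
  rfl

theorem VFunctor.id_comp {A B : VCat.{w} k V} (F : VFunctor A B) : (VFunctor.id A).comp F = F := by
  simp only [VFunctor.comp, VFunctor.id, Category.id_comp]

theorem VFunctor.comp_id {A B : VCat.{w} k V} (F : VFunctor A B) : F.comp (VFunctor.id B) = F := by
  simp only [VFunctor.comp, VFunctor.id, Category.comp_id]

theorem VFunctor.tensor_id (A B : VCat.{w} k V) :
    VFunctor.tensor (VFunctor.id A) (VFunctor.id B) = VFunctor.id (A.tensor B) := by
  simp only [VFunctor.tensor, VFunctor.id, tensorHom_id]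
  rfl

namespace V2Functor

/-- The identity `V`-2-functor. -/
def id (U : V2Cat.{w} k V) : V2Functor U U where
  obj a := a
  map a b := VFunctor.id _
  map_comp a b c := by
    rw [VFunctor.tensor_id, VFunctor.id_comp, VFunctor.comp_id]
  map_id a := VFunctor.comp_id _

/-- The composite of two `V`-2-functors, first `F`, then `G`. -/
def comp {U W X : V2Cat.{w} k V} (F : V2Functor U W) (G : V2Functor W X) : V2Functor U X where
  obj a := G.obj (F.obj a)
  map a b := (F.map a b).comp (G.map (F.obj a) (F.obj b))
  map_comp a b c := by
    rw [← VFunctor.comp_assoc, F.map_comp, VFunctor.comp_assoc, G.map_comp, VFunctor.tensor_comp,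
      VFunctor.comp_assoc]
  map_id a := by rw [← VFunctor.comp_assoc, F.map_id, G.map_id]

end V2Functor

/-- A `V`-2-natural transformation. -/
structure V2Nat {U W : V2Cat.{w} k V} (T S : V2Functor U W) where
  app : ∀ a : U.Obj, VFunctor (VCat.unitCat k V) (W.hom (T.obj a) (S.obj a))
  naturality : ∀ a b : U.Obj,
    (VFunctor.leftUnitorInv (U.hom a b)).comp
        ((VFunctor.tensor (app b) (T.map a b)).comp (W.comp (T.obj a) (T.obj b) (S.obj b))) =
      (VFunctor.rightUnitorInv (U.hom a b)).comp
        ((VFunctor.tensor (S.map a b) (app a)).comp (W.comp (T.obj a) (S.obj a) (S.obj b)))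

namespace V2Nat

variable {U W : V2Cat.{w} k V} {T S : V2Functor U W}

/-- The 1-cell `θ_a(0)` of `W(Ta, Sa)` given by a `V`-2-natural transformation. -/
def cell (θ : V2Nat T S) (a : U.Obj) : (W.hom (T.obj a) (S.obj a)).Obj :=
  (θ.app a).obj PUnit.unit

theorem naturality_obj (θ : V2Nat T S) {a b : U.Obj} (f : (U.hom a b).Obj) :
    (W.comp (T.obj a) (T.obj b) (S.obj b)).obj (θ.cell b, (T.map a b).obj f) =
      (W.comp (T.obj a) (S.obj a) (S.obj b)).obj ((S.map a b).obj f, θ.cell a) :=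
  congrArg (fun F : VFunctor _ _ => F.obj f) (θ.naturality a b)

end V2Nat

/-- A `V`-modification. -/
structure VModification {U W : V2Cat.{w} k V} {T S : V2Functor U W} (θ φ : V2Nat T S) where
  app : ∀ a : U.Obj, (unit k : V) ⟶ (W.hom (T.obj a) (S.obj a)).hom (θ.cell a) (φ.cell a)
  naturality : ∀ (a b : U.Obj) (f g : (U.hom a b).Obj),
    eqToHom (unit_tensorObj (two k) ((U.hom a b).hom f g)).symm ≫
        tensorHom (two k) (app b) ((T.map a b).map f g) ≫
        (W.comp (T.obj a) (T.obj b) (S.obj b)).map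
          (θ.cell b, (T.map a b).obj f) (φ.cell b, (T.map a b).obj g) ≫
        eqToHom (by rw [θ.naturality_obj f, φ.naturality_obj g]) =
      eqToHom (tensorObj_unit (two k) ((U.hom a b).hom f g)).symm ≫
        tensorHom (two k) ((S.map a b).map f g) (app a) ≫
        (W.comp (T.obj a) (S.obj a) (S.obj b)).map
          ((S.map a b).obj f, θ.cell a) ((S.map a b).obj g, φ.cell a)

/-- The composite `I = I ⊗₁ I → A(b,c) ⊗₁ A(a,b) → A(a,c)`. -/
def VCat.pointComp (A : VCat.{w} k V) {a b c : A.Obj} (y : unit k ⟶ A.hom b c)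
    (x : unit k ⟶ A.hom a b) : unit k ⟶ A.hom a c :=
  eqToHom (unit_tensorObj (one k) (unit k)).symm ≫ tensorHom (one k) y x ≫ A.comp a b c

namespace V2Cat

/-- The composite `𝓘 = 𝓘 ⊗ 𝓘 → W(b,c) ⊗ W(a,b) → W(a,c)` of `V`-functors. -/
def cellComp (W : V2Cat.{w} k V) {a b c : W.Obj}
    (q : VFunctor (VCat.unitCat k V) (W.hom b c)) (p : VFunctor (VCat.unitCat k V) (W.hom a b)) :
    VFunctor (VCat.unitCat k V) (W.hom a c) :=
  (VFunctor.leftUnitorInv (VCat.unitCat k V)).comp ((VFunctor.tensor q p).comp (W.comp a b c))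

/-- The composite `I = I ⊗₂ I → W(b,c)(g,g') ⊗₂ W(a,b)(f,f') → W(a,c)(gf,g'f')`. -/
def pointComp (W : V2Cat.{w} k V) {a b c : W.Obj} {g g' : (W.hom b c).Obj} {f f' : (W.hom a b).Obj}
    (y : unit k ⟶ (W.hom b c).hom g g') (x : unit k ⟶ (W.hom a b).hom f f') :
    unit k ⟶ (W.hom a c).hom ((W.comp a b c).obj (g, f)) ((W.comp a b c).obj (g', f')) :=
  eqToHom (unit_tensorObj (two k) (unit k)).symm ≫ tensorHom (two k) y x ≫
    (W.comp a b c).map (g, f) (g', f')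

end V2Cat

end

section
open MonoidalCategory

/-- A category structure on `C` with prescribed types of morphisms. -/
structure CategoryOn {C : Type w} (Hom : C → C → Type v) where
  id : ∀ X : C, Hom X X
  comp : ∀ {X Y Z : C}, Hom X Y → Hom Y Z → Hom X Z
  id_comp : ∀ {X Y : C} (f : Hom X Y), comp (id X) f = f
  comp_id : ∀ {X Y : C} (f : Hom X Y), comp f (id Y) = f
  assoc : ∀ {X Y Z W : C} (f : Hom X Y) (g : Hom Y Z) (h : Hom Z W),
    comp (comp f g) h = comp f (comp g h)

/-- The category given by a `CategoryOn`. -/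
@[reducible] def CategoryOn.toCategory {C : Type w} {Hom : C → C → Type v} (S : CategoryOn Hom) :
    Category.{v} C where
  Hom := Hom
  id := S.id
  comp := S.comp
  id_comp := S.id_comp
  comp_id := S.comp_id
  assoc := S.assoc

/-- The object of `Cat` given by a `CategoryOn`. -/
@[reducible] def CategoryOn.toCat {C : Type w} {Hom : C → C → Type v} (S : CategoryOn Hom) :
    Cat.{v, w} :=
  @Cat.of C S.toCategory

/-- An `E`-enriched category structure on `C` with prescribed hom-objects; the fields are those of
`EnrichedCategory`. -/
structure EnrichedCategoryOn {E : Type u} [Category.{v} E] [MonoidalCategory E] {C : Type w}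
    (Hom : C → C → E) where
  id : ∀ X : C, 𝟙_ E ⟶ Hom X X
  comp : ∀ X Y Z : C, Hom X Y ⊗ Hom Y Z ⟶ Hom X Z
  id_comp : ∀ X Y : C, (λ_ (Hom X Y)).inv ≫ id X ▷ _ ≫ comp X X Y = 𝟙 _
  comp_id : ∀ X Y : C, (ρ_ (Hom X Y)).inv ≫ _ ◁ id Y ≫ comp X Y Y = 𝟙 _
  assoc : ∀ W X Y Z : C, (α_ _ _ _).inv ≫ comp W X Y ▷ _ ≫ comp W Y Z =
    _ ◁ comp X Y Z ≫ comp W X Z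

/-- The enriched category given by an `EnrichedCategoryOn`. -/
@[reducible] def EnrichedCategoryOn.toEnrichedCategory {E : Type u} [Category.{v} E]
    [MonoidalCategory E] {C : Type w} {Hom : C → C → E} (S : EnrichedCategoryOn Hom) :
    EnrichedCategory E C where
  Hom := Hom
  id := S.id
  comp := S.comp
  id_comp := S.id_comp
  comp_id := S.comp_id
  assoc := S.assoc

end

/-- The 2-category given by a `Cat`-enriched structure. -/
def EnrichedCategoryOn.toTwoCat {C : Type m} {Hom : C → C → Cat.{m, m}}
    (S : EnrichedCategoryOn Hom) : TwoCat.{m} where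
  carrier := C
  str := S.toEnrichedCategory

/-- A (strict) 3-category, i.e. a category enriched over 2-Cat, with prescribed cells: its objects
are the elements of `C` and its 1-, 2- and 3-cells are given by `H₁`, `H₂` and `H₃`. The structure
consists of a category of 2-cells and 3-cells between any two parallel 1-cells, a 2-category (with
these hom-categories) of 1-, 2- and 3-cells between any two objects, and the structure of a category
enriched over 2-Cat with these hom-2-categories. -/
structure ThreeCategoryOn {C : Type u} (H₁ : C → C → Type m)
    (H₂ : ∀ {A B : C}, H₁ A B → H₁ A B → Type m)
    (H₃ : ∀ {A B : C} {F G : H₁ A B}, H₂ F G → H₂ F G → Type m) where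
  homCat : ∀ {A B : C} (F G : H₁ A B), CategoryOn (H₃ (F := F) (G := G))
  homTwoCat : ∀ A B : C, EnrichedCategoryOn fun F G : H₁ A B => (homCat F G).toCat
  enriched : EnrichedCategoryOn fun A B : C => (homTwoCat A B).toTwoCat

namespace ThreeCategoryOn

variable {C : Type u} {H₁ : C → C → Type m}
    {H₂ : ∀ {A B : C}, H₁ A B → H₁ A B → Type m}
    {H₃ : ∀ {A B : C} {F G : H₁ A B}, H₂ F G → H₂ F G → Type m} (S : ThreeCategoryOn H₁ H₂ H₃)

/-- The underlying category enriched over 2-Cat. -/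
@[reducible] def toEnrichedCategory : EnrichedCategory TwoCat.{m} C :=
  S.enriched.toEnrichedCategory

/-- The identity 3-cell of a 2-cell. -/
def id₃ {A B : C} {F G : H₁ A B} (α : H₂ F G) : H₃ α α :=
  (S.homCat F G).id α

/-- Composition of 3-cells along a 2-cell: first `μ`, then `ν`. -/
def vert {A B : C} {F G : H₁ A B} {α β γ : H₂ F G} (μ : H₃ α β) (ν : H₃ β γ) : H₃ α γ :=
  (S.homCat F G).comp μ ν

/-- The identity 2-cell of a 1-cell. -/
def id₂ {A B : C} (F : H₁ A B) : H₂ F F :=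
  ((S.homTwoCat A B).id F).toFunctor.obj ⟨⟨⟨⟩⟩⟩

/-- Composition of 2-cells along a 1-cell: first `α`, then `β`. -/
def hor₂ {A B : C} {F G H : H₁ A B} (α : H₂ F G) (β : H₂ G H) : H₂ F H :=
  ((S.homTwoCat A B).comp F G H).toFunctor.obj (α, β)

/-- Composition of 3-cells along a 1-cell. -/
def hor₃ {A B : C} {F G H : H₁ A B} {α α' : H₂ F G} {β β' : H₂ G H} (μ : H₃ α α')
    (ν : H₃ β β') : H₃ (S.hor₂ α β) (S.hor₂ α' β') :=
  ((S.homTwoCat A B).comp F G H).toFunctor.map (X := (α, β)) (Y := (α', β')) (μ, ν)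

/-- The identity 1-cell of an object. -/
def id₁ (A : C) : H₁ A A :=
  TwoCat.obj (S.enriched.id A) PUnit.unit

/-- Composition of 1-cells along an object: first `F`, then `G`. -/
def comp₁ {A B D : C} (F : H₁ A B) (G : H₁ B D) : H₁ A D :=
  TwoCat.obj (S.enriched.comp A B D) (F, G)

/-- Composition of 2-cells along an object. -/
def comp₂ {A B D : C} {F F' : H₁ A B} {G G' : H₁ B D} (α : H₂ F F') (β : H₂ G G') :
    H₂ (S.comp₁ F G) (S.comp₁ F' G') :=
  (TwoCat.map (S.enriched.comp A B D) (F, G) (F', G')).toFunctor.obj (α, β)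

/-- Composition of 3-cells along an object. -/
def comp₃ {A B D : C} {F F' : H₁ A B} {G G' : H₁ B D} {α α' : H₂ F F'} {β β' : H₂ G G'}
    (μ : H₃ α α') (ν : H₃ β β') : H₃ (S.comp₂ α β) (S.comp₂ α' β') :=
  (TwoCat.map (S.enriched.comp A B D) (F, G) (F', G')).toFunctor.map
    (X := (α, β)) (Y := (α', β')) (μ, ν)

end ThreeCategoryOn

/-! The argument is Yoneda-style. A generalized element of a hom-object of a `V`-category is a
morphism out of an arbitrary `X : V`, bundled with its source and target. `V`-functors act on such
elements, and by taking the identity morphism as element, equalities of `V`-functors become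
equalities of elements. Bundling the endpoints absorbs the transports caused by equations between
objects. The composites `vcomp` (along ⊗₁) and `hcomp` (along ⊗₂) carry a proof that the product of
the shapes is a given object, which absorbs the transports caused by the strict unit.

In these terms a `V`-2-category behaves like an ordinary 2-category, provided enough of the shapes
involved are the unit `I`. Interchange of `vcomp` and `hcomp` holds where η¹² is an identity, as it
does when its last two arguments are `I` (`hcomp_vcomp`). Associativity of `hcomp` holds up to
precomposition with α² (`hcomp_assoc_precomp`), and this precomposition is trivial when two of the
three shapes are `I` (`hcomp_assoc_right`, `hcomp_assoc_middle`, `hcomp_assoc_left`).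

A `V`-2-natural transformation amounts to a family of 1-cells whose identity 2-cells are natural,
and a `V`-modification to a natural family of 2-cells of shape `I`. Naturality against elements of
every shape is the single condition `IsNatural`. It is closed under the three compositions
(`IsNatural.vcomp`, `IsNatural.hcomp`, `IsNatural.whisker`), so all composites are well defined.
Since transformations and modifications are determined by their cells, every 3-category axiom
reduces to the same computation as in 2-Cat, done componentwise. -/

section
open IteratedMonoidal

variable {k : ℕ} [Fact (2 ≤ k)] {V : Type u} [Category.{v} V] [IteratedMonoidal k V]

/-! ### Generalized elements of `V`-categories and their composition. -/

/-- A generalized element of shape `X` of a hom-object of the `V`-category `A`, together with its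
source and target. -/
structure VCat.Cell (A : VCat.{w} k V) (X : V) where
  src : A.Obj
  tgt : A.Obj
  el : X ⟶ A.hom src tgt

namespace VCat.Cell

variable {A B C D : VCat.{w} k V} {X Y Z : V}

/-- The bridge between equations transported along equal endpoints, as in the definition of a
modification, and plain equality of bundled elements. -/
theorem mk_eq_mk_iff {s s' t t' : A.Obj} (hs : s = s') (ht : t = t') (e : X ⟶ A.hom s t)
    (e' : X ⟶ A.hom s' t') :
    mk s t e = mk s' t' e' ↔ e ≫ eqToHom (by rw [hs, ht]) = e' := by
  subst hs ht
  simp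

theorem heq_el {x y : A.Cell X} (h : x = y) : HEq x.el y.el := by rw [h]

/-- Reindexing of a generalized element. -/
def precomp (f : Y ⟶ X) (x : A.Cell X) : A.Cell Y := ⟨x.src, x.tgt, f ≫ x.el⟩

/-- The identity element of an object. -/
def idCell (a : A.Obj) : A.Cell (unit k) := ⟨a, a, A.id a⟩

/-- The pairing of generalized elements of two `V`-categories. -/
def tensor (p : tensorObj (two k) Y X = Z) (y : B.Cell Y) (x : A.Cell X) : (B.tensor A).Cell Z :=
  ⟨(y.src, x.src), (y.tgt, x.tgt), eqToHom p.symm ≫ tensorHom (two k) y.el x.el⟩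

/-- The composite of generalized elements of two composable hom-objects. -/
def vcomp (p : tensorObj (one k) Y X = Z) (y : A.Cell Y) (x : A.Cell X) (h : x.tgt = y.src) :
    A.Cell Z :=
  ⟨x.src, y.tgt, eqToHom p.symm ≫ tensorHom (one k) y.el
    (x.el ≫ eqToHom (by rw [h])) ≫ A.comp x.src y.src y.tgt⟩

theorem vcomp_congr (p : tensorObj (one k) Y X = Z) {y y' : A.Cell Y}
    {x x' : A.Cell X} (hy : y = y') (hx : x = x') (h : x.tgt = y.src) :
    vcomp p y x h = vcomp p y' x' (by rw [← hy, ← hx, h]) := by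
  subst hy hx
  rfl

theorem vcomp_mk (p : tensorObj (one k) Y X = Z) {a b c : A.Obj} (y : Y ⟶ A.hom b c)
    (x : X ⟶ A.hom a b) (h : b = b) :
    vcomp p (mk b c y) (mk a b x) h =
      mk a c (eqToHom p.symm ≫ tensorHom (one k) y x ≫ A.comp a b c) := by
  simp [vcomp]

theorem vcomp_idCell (x : A.Cell X) : vcomp (tensorObj_unit _ X) x (idCell x.src) rfl = x := by
  obtain ⟨s, t, e⟩ := x
  refine (vcomp_mk _ _ _ rfl).trans (congrArg (mk _ _) ?_)
  have h : tensorHom (one k) e (A.id s) =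
      tensorHom (one k) e (𝟙 _) ≫ tensorHom (one k) (𝟙 _) (A.id s) := by
    rw [← tensorHom_comp, Category.comp_id, Category.id_comp]
  rw [h, Category.assoc, A.comp_id, tensorHom_unit]
  simp

theorem idCell_vcomp (x : A.Cell X) : vcomp (unit_tensorObj _ X) (idCell x.tgt) x rfl = x := by
  obtain ⟨s, t, e⟩ := x
  refine (vcomp_mk _ _ _ rfl).trans (congrArg (mk _ _) ?_)
  have h : tensorHom (one k) (A.id t) e =
      tensorHom (one k) (𝟙 _) e ≫ tensorHom (one k) (A.id t) (𝟙 _) := by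
    rw [← tensorHom_comp, Category.comp_id, Category.id_comp]
  rw [h, Category.assoc, A.id_comp, unit_tensorHom]
  simp

/-- The interchange law, for elements at whose shapes `η¹²` is an identity. -/
theorem tensor_vcomp {X Y X' Y' P Q R S T : V}
    (p : tensorObj (one k) Y' Y = P)
    (q : tensorObj (one k) X' X = Q) (r : tensorObj (two k) P Q = T)
    (s : tensorObj (two k) Y X = R) (s' : tensorObj (two k) Y' X' = S)
    (t : tensorObj (one k) S R = T) (e)
    (hη : inter (one_lt_two k) Y' X' Y X = eqToHom e)
    (y' : B.Cell Y') (y : B.Cell Y) (x' : A.Cell X') (x : A.Cell X) (hy : y.tgt = y'.src)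
    (hx : x.tgt = x'.src) (h : (tensor s y x).tgt = (tensor s' y' x').src) :
    tensor r (vcomp p y' y hy) (vcomp q x' x hx) = vcomp t (tensor s' y' x') (tensor s y x) h := by
  obtain ⟨y₁, y₂, y⟩ := y
  obtain ⟨y₁', y₂', y'⟩ := y'
  obtain ⟨x₁, x₂, x⟩ := x
  obtain ⟨x₁', x₂', x'⟩ := x'
  obtain rfl : y₂ = y₁' := hy
  obtain rfl : x₂ = x₁' := hx
  subst p q s s'
  rw [vcomp_mk, vcomp_mk]
  refine Eq.trans (congrArg (mk _ _) ?_) (vcomp_mk (A := B.tensor A) (a := (y₁, x₁)) (b := (y₂, x₂))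
    (c := (y₂', x₂')) t (eqToHom rfl ≫ tensorHom (two k) y' x')
    (eqToHom rfl ≫ tensorHom (two k) y x) rfl).symm
  have h := inter_naturality (one_lt_two k) y' x' y x
  -- Only the component of η at the shapes becomes an identity; the one at the hom-objects stays,
  -- being part of the composition of `B.tensor A`.
  rw [hη] at h
  have h' : eqToHom r.symm ≫ tensorHom (two k)
      (eqToHom rfl ≫ tensorHom (one k) y' y ≫ B.comp y₁ y₂ y₂')
      (eqToHom rfl ≫ tensorHom (one k) x' x ≫ A.comp x₁ x₂ x₂') =
      eqToHom t.symm ≫ tensorHom (one k) (eqToHom rfl ≫ tensorHom (two k) y' x')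
        (eqToHom rfl ≫ tensorHom (two k) y x) ≫
        inter (one_lt_two k) _ _ _ _ ≫ tensorHom (two k) (B.comp y₁ y₂ y₂') (A.comp x₁ x₂ x₂') := by
    simp only [eqToHom_refl, Category.id_comp]
    rw [reassoc_of% h, ← tensorHom_comp]
    simp
  exact h'

end VCat.Cell

/-! ### The underlying category of a `V`-category. -/

namespace VCat

variable (A : VCat.{w} k V) {a b c d : A.Obj}

theorem pointComp_id (x : unit k ⟶ A.hom a b) : A.pointComp x (A.id a) = x := by
  have h := (Cell.vcomp_mk (tensorObj_unit _ _) x (A.id a) rfl).symm.trans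
    (Cell.vcomp_idCell ⟨a, b, x⟩)
  exact (Category.comp_id _).symm.trans ((Cell.mk_eq_mk_iff rfl rfl _ _).1 h)

theorem id_pointComp (x : unit k ⟶ A.hom a b) : A.pointComp (A.id b) x = x := by
  have h := (Cell.vcomp_mk (unit_tensorObj _ _) (A.id b) x rfl).symm.trans
    (Cell.idCell_vcomp ⟨a, b, x⟩)
  exact (Category.comp_id _).symm.trans ((Cell.mk_eq_mk_iff rfl rfl _ _).1 h)

/-- By naturality, the associator in the `V`-category axiom can be moved to its component at three
copies of `I`, which is an identity by the pentagon (`assoc_unit`). -/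
theorem pointComp_assoc (z : unit k ⟶ A.hom c d) (y : unit k ⟶ A.hom b c)
    (x : unit k ⟶ A.hom a b) :
    A.pointComp (A.pointComp z y) x = A.pointComp z (A.pointComp y x) := by
  have hu : tensorObj (one k) (unit k : V) (unit k) = unit k := unit_tensorObj _ _
  have h₁ : tensorHom (one k) (A.pointComp z y) x =
      eqToHom (by rw [hu, hu]) ≫ tensorHom (one k) (tensorHom (one k) z y) x ≫
        tensorHom (one k) (A.comp b c d) (𝟙 _) := by
    rw [← tensorHom_comp, Category.comp_id, pointComp,
      ← tensorHom_eqToHom (one k) hu.symm (rfl : (unit k : V) = unit k), ← tensorHom_comp,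
      eqToHom_refl, Category.id_comp]
  have h₂ : tensorHom (one k) z (A.pointComp y x) =
      eqToHom (by rw [hu, hu]) ≫ tensorHom (one k) z (tensorHom (one k) y x) ≫
        tensorHom (one k) (𝟙 _) (A.comp a b c) := by
    rw [← tensorHom_comp, Category.comp_id, pointComp,
      ← tensorHom_eqToHom (one k) (rfl : (unit k : V) = unit k) hu.symm, ← tensorHom_comp,
      eqToHom_refl, Category.id_comp]
  rw [pointComp, h₁, pointComp, h₂]
  simp only [Category.assoc]
  rw [A.assoc, reassoc_of% (assoc_naturality (one k) z y x), assoc_unit]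
  simp

end VCat

/-! ### Action of `V`-functors on generalized elements. -/

namespace VFunctor

variable {A B C D A' B' : VCat.{w} k V} {X Y Z : V}

/-- The action of a `V`-functor on generalized elements. -/
def mapCell (F : VFunctor A B) (x : A.Cell X) : B.Cell X :=
  ⟨F.obj x.src, F.obj x.tgt, x.el ≫ F.map x.src x.tgt⟩

theorem comp_mapCell (F : VFunctor A B) (G : VFunctor B C) (x : A.Cell X) :
    (F.comp G).mapCell x = G.mapCell (F.mapCell x) := by
  simp [mapCell, comp]

theorem id_mapCell (x : A.Cell X) : (VFunctor.id A).mapCell x = x := by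
  simp [mapCell, VFunctor.id]

theorem mapCell_precomp (F : VFunctor A B) (f : Y ⟶ X) (x : A.Cell X) :
    F.mapCell (x.precomp f) = (F.mapCell x).precomp f := by
  simp [mapCell, VCat.Cell.precomp]

theorem mapCell_idCell (F : VFunctor A B) (a : A.Obj) :
    F.mapCell (VCat.Cell.idCell a) = VCat.Cell.idCell (F.obj a) := by
  simp [mapCell, VCat.Cell.idCell, F.map_id]

theorem tensor_mapCell (F : VFunctor A A') (G : VFunctor B B')
    (p : tensorObj (two k) Y X = Z) (y : A.Cell Y) (x : B.Cell X) :
    (F.tensor G).mapCell (y.tensor p x) = (F.mapCell y).tensor p (G.mapCell x) := by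
  refine congrArg (VCat.Cell.mk _ _) (Eq.trans (Category.assoc _ _ _) ?_)
  exact congrArg _ (tensorHom_comp _ _ _ _ _).symm

theorem mapCell_vcomp (F : VFunctor A B) (p : tensorObj (one k) Y X = Z) (y : A.Cell Y)
    (x : A.Cell X) (h : x.tgt = y.src) :
    F.mapCell (y.vcomp p x h) = (F.mapCell y).vcomp p (F.mapCell x) (congrArg F.obj h) := by
  obtain ⟨y₁, y₂, y⟩ := y
  obtain ⟨x₁, x₂, x⟩ := x
  obtain rfl : x₂ = y₁ := h
  simp [mapCell, VCat.Cell.vcomp, F.map_comp, tensorHom_comp]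

/-- Two `V`-functors agree when they agree on generic elements. -/
theorem ext_of_mapCell {F G : VFunctor A B}
    (h : ∀ a a' : A.Obj, F.mapCell ⟨a, a', 𝟙 _⟩ = G.mapCell ⟨a, a', 𝟙 _⟩) : F = G := by
  obtain ⟨o, f, _, _⟩ := F
  obtain ⟨o', f', _, _⟩ := G
  -- Elements carry their endpoints, so the hypothesis also determines the object maps.
  obtain rfl : o = o' := funext fun a => congrArg VCat.Cell.src (h a a)
  obtain rfl : f = f' := by
    funext a a'
    simpa [mapCell] using h a a'
  rfl

theorem associator_mapCell {X Y Z P Q R : V} (p : tensorObj (two k) Z Y = P)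
    (q : tensorObj (two k) Y X = Q) (r : tensorObj (two k) P X = R) (s : tensorObj (two k) Z Q = R)
    (z : C.Cell Z) (y : B.Cell Y) (x : A.Cell X) :
    (associator C B A).mapCell ((z.tensor p y).tensor r x) =
      (z.tensor s (y.tensor q x)).precomp (eqToHom (by rw [p, r]) ≫
        (assoc (two k) Z Y X).hom ≫ eqToHom (by rw [q, s])) := by
  subst p q r
  have h : (eqToHom rfl ≫ tensorHom (two k) (eqToHom rfl ≫ tensorHom (two k) z.el y.el) x.el) ≫
      (assoc (two k) _ _ _).hom = (eqToHom rfl ≫ (assoc (two k) Z Y X).hom ≫ eqToHom s) ≫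
      eqToHom s.symm ≫ tensorHom (two k) z.el (eqToHom rfl ≫ tensorHom (two k) y.el x.el) := by
    simp [assoc_naturality]
  exact congrArg (VCat.Cell.mk _ _) h

theorem leftUnitor_mapCell (x : A.Cell X) (y : (VCat.unitCat k V).Obj) :
    (leftUnitor A).mapCell ((VCat.Cell.idCell y).tensor (unit_tensorObj (two k) X) x) = x := by
  refine congrArg (VCat.Cell.mk _ _) (?_ : (eqToHom _ ≫ tensorHom (two k) (𝟙 (unit k)) x.el) ≫
    eqToHom (unit_tensorObj (two k) _) = _)
  simp [unit_tensorHom]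

theorem rightUnitor_mapCell (x : A.Cell X) (y : (VCat.unitCat k V).Obj) :
    (rightUnitor A).mapCell (x.tensor (tensorObj_unit (two k) X) (VCat.Cell.idCell y)) = x := by
  refine congrArg (VCat.Cell.mk _ _) (?_ : (eqToHom _ ≫ tensorHom (two k) x.el (𝟙 (unit k))) ≫
    eqToHom (tensorObj_unit (two k) _) = _)
  simp [tensorHom_unit]

theorem leftUnitorInv_mapCell (x : A.Cell X) :
    (leftUnitorInv A).mapCell x =
      (VCat.Cell.idCell (A := VCat.unitCat k V) PUnit.unit).tensor
        (unit_tensorObj (two k) X) x := by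
  refine congrArg (VCat.Cell.mk _ _) (?_ : x.el ≫ eqToHom (unit_tensorObj (two k) _).symm =
    eqToHom (unit_tensorObj (two k) X).symm ≫ tensorHom (two k) (𝟙 (unit k)) x.el)
  simp [unit_tensorHom]

theorem rightUnitorInv_mapCell (x : A.Cell X) :
    (rightUnitorInv A).mapCell x =
      x.tensor (tensorObj_unit (two k) X)
        (VCat.Cell.idCell (A := VCat.unitCat k V) PUnit.unit) := by
  refine congrArg (VCat.Cell.mk _ _) (?_ : x.el ≫ eqToHom (tensorObj_unit (two k) _).symm =
    eqToHom (tensorObj_unit (two k) X).symm ≫ tensorHom (two k) x.el (𝟙 (unit k)))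
  simp [tensorHom_unit]

theorem mapCell_id (F : VFunctor A B) (a a' : A.Obj) :
    F.mapCell ⟨a, a', 𝟙 _⟩ = ⟨F.obj a, F.obj a', F.map a a'⟩ := by
  simp [mapCell]

theorem leftUnitorInv_comp_mapCell (F : VFunctor (VCat.unitCat k V) B) (G : VFunctor A A')
    (H : VFunctor (B.tensor A') C) (x : A.Cell X) :
    ((leftUnitorInv A).comp ((F.tensor G).comp H)).mapCell x =
      H.mapCell ((VCat.Cell.idCell (F.obj PUnit.unit)).tensor (unit_tensorObj _ X)
        (G.mapCell x)) := by
  rw [comp_mapCell, comp_mapCell, leftUnitorInv_mapCell, tensor_mapCell]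
  exact congrArg (fun c => H.mapCell (VCat.Cell.tensor _ c _)) (F.mapCell_idCell _)

theorem rightUnitorInv_comp_mapCell (F : VFunctor (VCat.unitCat k V) B) (G : VFunctor A A')
    (H : VFunctor (A'.tensor B) C) (x : A.Cell X) :
    ((rightUnitorInv A).comp ((G.tensor F).comp H)).mapCell x =
      H.mapCell ((G.mapCell x).tensor (tensorObj_unit _ X)
        (VCat.Cell.idCell (F.obj PUnit.unit))) := by
  rw [comp_mapCell, comp_mapCell, rightUnitorInv_mapCell, tensor_mapCell]
  exact congrArg (fun c => H.mapCell (VCat.Cell.tensor _ _ c)) (F.mapCell_idCell _)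

/-- The `V`-functor from the unit `V`-category with a given value. -/
def point (a : A.Obj) : VFunctor (VCat.unitCat k V) A where
  obj _ := a
  map _ _ := A.id a
  map_comp _ _ _ := by
    have h : tensorHom (one k) (A.id a) (A.id a) =
        tensorHom (one k) (𝟙 _) (A.id a) ≫ tensorHom (one k) (A.id a) (𝟙 _) := by
      rw [← tensorHom_comp, Category.comp_id, Category.id_comp]
    have h' : eqToHom (unit_tensorObj (one k) (unit k : V)) ≫ A.id a =
        tensorHom (one k) (A.id a) (A.id a) ≫ A.comp a a a := by
      rw [h, Category.assoc, A.id_comp, unit_tensorHom]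
      simp
    exact h'
  map_id _ := Category.id_comp _

/-- The generic element of the unit `V`-category is its identity element, so preservation of
identities forces the action on the hom-object. -/
theorem ext_of_obj {F G : VFunctor (VCat.unitCat k V) A}
    (h : F.obj PUnit.unit = G.obj PUnit.unit) : F = G := by
  apply ext_of_mapCell
  intro a a'
  exact (F.mapCell_idCell a).trans ((congrArg VCat.Cell.idCell h).trans (G.mapCell_idCell a).symm)

end VFunctor

/-! ### Horizontal composition of generalized 2-cells. -/

namespace V2Cat

variable (W : V2Cat.{w} k V) {a b c d : W.Obj} {X Y Z : V}

/-- The 1-cell given by a composable pair of 1-cells. -/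
def ocomp (g : (W.hom b c).Obj) (f : (W.hom a b).Obj) : (W.hom a c).Obj :=
  (W.comp a b c).obj (g, f)

/-- The identity 1-cell. -/
def oid (a : W.Obj) : (W.hom a a).Obj := (W.id a).obj PUnit.unit

/-- The horizontal composite of generalized 2-cells. -/
def hcomp (p : tensorObj (two k) Y X = Z) (y : (W.hom b c).Cell Y) (x : (W.hom a b).Cell X) :
    (W.hom a c).Cell Z :=
  (W.comp a b c).mapCell (y.tensor p x)

theorem id_mapCell_idCell (a : W.Obj) (t : (VCat.unitCat k V).Obj) :
    (W.id a).mapCell (VCat.Cell.idCell t) = VCat.Cell.idCell (W.oid a) :=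
  VFunctor.mapCell_idCell _ _

theorem idCell_hcomp (x : (W.hom a b).Cell X) :
    W.hcomp (unit_tensorObj (two k) X) (VCat.Cell.idCell (W.oid b)) x = x := by
  have h := congrArg (fun F => VFunctor.mapCell F ((VCat.Cell.idCell PUnit.unit).tensor
    (unit_tensorObj (two k) X) x)) (W.id_comp a b)
  replace h := h.trans (VFunctor.leftUnitor_mapCell x PUnit.unit)
  rw [VFunctor.comp_mapCell, VFunctor.tensor_mapCell, VFunctor.id_mapCell] at h
  exact (congrArg (fun c => (W.comp a b b).mapCell (VCat.Cell.tensor _ c x))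
    (W.id_mapCell_idCell b PUnit.unit).symm).trans h

theorem hcomp_idCell (x : (W.hom a b).Cell X) :
    W.hcomp (tensorObj_unit (two k) X) x (VCat.Cell.idCell (W.oid a)) = x := by
  have h := congrArg (fun F => VFunctor.mapCell F (x.tensor
    (tensorObj_unit (two k) X) (VCat.Cell.idCell PUnit.unit))) (W.comp_id a b)
  replace h := h.trans (VFunctor.rightUnitor_mapCell x PUnit.unit)
  rw [VFunctor.comp_mapCell, VFunctor.tensor_mapCell, VFunctor.id_mapCell] at h
  exact (congrArg (fun c => (W.comp a a b).mapCell (VCat.Cell.tensor _ x c))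
    (W.id_mapCell_idCell a PUnit.unit).symm).trans h

theorem hcomp_mk {g g' : (W.hom b c).Obj} {f f' : (W.hom a b).Obj}
    (y : unit k ⟶ (W.hom b c).hom g g') (x : unit k ⟶ (W.hom a b).hom f f') :
    W.hcomp (unit_tensorObj _ _) ⟨g, g', y⟩ ⟨f, f', x⟩ =
      ⟨W.ocomp g f, W.ocomp g' f', W.pointComp y x⟩ :=
  congrArg (VCat.Cell.mk _ _) (Category.assoc _ _ _)

/-- Because the other factor has shape `I`, strictness of the unit on morphisms identifies 𝟙 ⊗₂ f
with f. This is what extends naturality from generic elements to arbitrary ones. -/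
theorem hcomp_precomp_right (y : (W.hom b c).Cell (unit k)) (x : (W.hom a b).Cell X) (f : Y ⟶ X) :
    W.hcomp (unit_tensorObj _ Y) y (x.precomp f) =
      (W.hcomp (unit_tensorObj _ X) y x).precomp f := by
  have h : eqToHom (unit_tensorObj (two k) Y).symm ≫ tensorHom (two k) y.el (f ≫ x.el) =
      f ≫ eqToHom (unit_tensorObj (two k) X).symm ≫ tensorHom (two k) y.el x.el := by
    rw [show tensorHom (two k) y.el (f ≫ x.el) =
      tensorHom (two k) (𝟙 _) f ≫ tensorHom (two k) y.el x.el
      by rw [← tensorHom_comp, Category.id_comp], unit_tensorHom]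
    simp
  exact (congrArg (fun t => (W.comp a b c).mapCell ⟨(y.src, x.src), (y.tgt, x.tgt), t⟩) h).trans
    (VFunctor.mapCell_precomp (W.comp a b c) f (y.tensor _ x))

theorem hcomp_precomp_left (y : (W.hom b c).Cell X) (x : (W.hom a b).Cell (unit k)) (f : Y ⟶ X) :
    W.hcomp (tensorObj_unit _ Y) (y.precomp f) x =
      (W.hcomp (tensorObj_unit _ X) y x).precomp f := by
  have h : eqToHom (tensorObj_unit (two k) Y).symm ≫ tensorHom (two k) (f ≫ y.el) x.el =
      f ≫ eqToHom (tensorObj_unit (two k) X).symm ≫ tensorHom (two k) y.el x.el := by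
    rw [show tensorHom (two k) (f ≫ y.el) x.el =
      tensorHom (two k) f (𝟙 _) ≫ tensorHom (two k) y.el x.el
      by rw [← tensorHom_comp, Category.id_comp], tensorHom_unit]
    simp
  exact (congrArg (fun t => (W.comp a b c).mapCell ⟨(y.src, x.src), (y.tgt, x.tgt), t⟩) h).trans
    (VFunctor.mapCell_precomp (W.comp a b c) f (y.tensor _ x))

/-- The associativity axiom of `W` evaluated on the element (z ⊗ y) ⊗ x; naturality of α² moves the
associator from the hom-objects to the shapes. -/
theorem hcomp_assoc_precomp {X Y Z P Q R : V} (p : tensorObj (two k) Z Y = P)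
    (q : tensorObj (two k) Y X = Q) (r : tensorObj (two k) P X = R) (s : tensorObj (two k) Z Q = R)
    (z : (W.hom c d).Cell Z) (y : (W.hom b c).Cell Y) (x : (W.hom a b).Cell X) :
    W.hcomp r (W.hcomp p z y) x =
      (W.hcomp s z (W.hcomp q y x)).precomp (eqToHom (by rw [p, r]) ≫
        (IteratedMonoidal.assoc (two k) Z Y X).hom ≫ eqToHom (by rw [q, s])) := by
  have h := congrArg (fun F => VFunctor.mapCell F ((z.tensor p y).tensor r x)) (W.assoc a b c d)
  simp only [VFunctor.comp_mapCell, VFunctor.tensor_mapCell, VFunctor.id_mapCell] at h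
  rw [VFunctor.associator_mapCell p q r s, VFunctor.mapCell_precomp,
    VFunctor.mapCell_precomp, VFunctor.tensor_mapCell, VFunctor.id_mapCell] at h
  exact h

/-- No triangle identity is assumed, so α² at (I, I, X) is not known to be an identity in `V`. It is
enough that precomposition with it fixes every 2-cell of `W`, and this follows from the unit axioms
of `W`. The two lemmas that follow treat the other positions of `X` in the same way. -/
theorem hcomp_assoc_right (z : (W.hom c d).Cell (unit k)) (y : (W.hom b c).Cell (unit k))
    (x : (W.hom a b).Cell X) :
    W.hcomp (unit_tensorObj _ X) (W.hcomp (unit_tensorObj _ _) z y) x =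
      W.hcomp (unit_tensorObj _ X) z (W.hcomp (unit_tensorObj _ X) y x) := by
  rw [W.hcomp_assoc_precomp _ (unit_tensorObj _ X) _ (unit_tensorObj _ X)]
  generalize W.hcomp (unit_tensorObj _ X) z (W.hcomp (unit_tensorObj _ X) y x) = t
  -- With two identity 2-cells of an identity 1-cell as outer factors, both bracketings collapse to
  -- `t`, leaving the equation between `t` and its reindexing along the associator.
  have h := W.hcomp_assoc_precomp (unit_tensorObj _ _) (unit_tensorObj _ X) (unit_tensorObj _ X)
    (unit_tensorObj _ X) (VCat.Cell.idCell (W.oid d)) (VCat.Cell.idCell (W.oid d)) t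
  simpa only [idCell_hcomp] using h.symm

theorem hcomp_assoc_middle (z : (W.hom c d).Cell (unit k)) (y : (W.hom b c).Cell X)
    (x : (W.hom a b).Cell (unit k)) :
    W.hcomp (tensorObj_unit _ X) (W.hcomp (unit_tensorObj _ _) z y) x =
      W.hcomp (unit_tensorObj _ X) z (W.hcomp (tensorObj_unit _ X) y x) := by
  rw [W.hcomp_assoc_precomp _ (tensorObj_unit _ X) _ (unit_tensorObj _ X)]
  generalize W.hcomp (unit_tensorObj _ X) z (W.hcomp (tensorObj_unit _ X) y x) = t
  have h := W.hcomp_assoc_precomp (unit_tensorObj _ _) (tensorObj_unit _ X) (tensorObj_unit _ X)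
    (unit_tensorObj _ X) (VCat.Cell.idCell (W.oid d)) t (VCat.Cell.idCell (W.oid a))
  simpa only [idCell_hcomp, hcomp_idCell] using h.symm

theorem hcomp_assoc_left (z : (W.hom c d).Cell X) (y : (W.hom b c).Cell (unit k))
    (x : (W.hom a b).Cell (unit k)) :
    W.hcomp (tensorObj_unit _ X) (W.hcomp (tensorObj_unit _ _) z y) x =
      W.hcomp (tensorObj_unit _ X) z (W.hcomp (unit_tensorObj _ _) y x) := by
  rw [W.hcomp_assoc_precomp _ (unit_tensorObj _ _) _ (tensorObj_unit _ X)]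
  generalize W.hcomp (tensorObj_unit _ X) z (W.hcomp (unit_tensorObj _ _) y x) = t
  have h := W.hcomp_assoc_precomp (tensorObj_unit _ _) (unit_tensorObj _ _) (tensorObj_unit _ X)
    (tensorObj_unit _ X) t (VCat.Cell.idCell (W.oid a)) (VCat.Cell.idCell (W.oid a))
  have h1 : W.hcomp (unit_tensorObj (two k) _) (VCat.Cell.idCell (W.oid a))
    (VCat.Cell.idCell (W.oid a)) = VCat.Cell.idCell (W.oid a) := W.idCell_hcomp _
  simpa only [h1, hcomp_idCell] using h.symm

theorem idCell_hcomp_idCell (g : (W.hom b c).Obj) (f : (W.hom a b).Obj) :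
    W.hcomp (unit_tensorObj _ _) (VCat.Cell.idCell g) (VCat.Cell.idCell f) =
      VCat.Cell.idCell (W.ocomp g f) :=
  VFunctor.mapCell_idCell _ _

theorem hcomp_vcomp {X Y X' Y' P Q R S T : V}
    (p : tensorObj (one k) Y' Y = P)
    (q : tensorObj (one k) X' X = Q) (r : tensorObj (two k) P Q = T)
    (s : tensorObj (two k) Y X = R) (s' : tensorObj (two k) Y' X' = S)
    (t : tensorObj (one k) S R = T) (e)
    (hη : inter (one_lt_two k) Y' X' Y X = eqToHom e)
    (y' : (W.hom b c).Cell Y') (y : (W.hom b c).Cell Y) (x' : (W.hom a b).Cell X')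
    (x : (W.hom a b).Cell X) (hy : y.tgt = y'.src) (hx : x.tgt = x'.src)
    (h : (W.hcomp s y x).tgt = (W.hcomp s' y' x').src) :
    W.hcomp r (y'.vcomp p y hy) (x'.vcomp q x hx) =
      (W.hcomp s' y' x').vcomp t (W.hcomp s y x) h := by
  have h' : (y.tensor s x).tgt = (y'.tensor s' x').src := Prod.ext hy hx
  exact (congrArg _ (VCat.Cell.tensor_vcomp p q r s s' t e hη y' y x' x hy hx h')).trans
    (VFunctor.mapCell_vcomp _ _ _ _ _)

end V2Cat

/-! ### Natural families of 2-cells and their closure properties. -/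

namespace V2Functor

variable {U W Y : V2Cat.{w} k V} {X P Q : V}

theorem mapCell_hcomp (F : V2Functor U W) {a b c : U.Obj} (p : tensorObj (two k) P X = Q)
    (y : (U.hom b c).Cell P) (x : (U.hom a b).Cell X) :
    (F.map a c).mapCell (U.hcomp p y x) =
      W.hcomp p ((F.map b c).mapCell y) ((F.map a b).mapCell x) := by
  have h := congrArg (fun G => VFunctor.mapCell G (y.tensor p x)) (F.map_comp a b c)
  rwa [VFunctor.comp_mapCell, VFunctor.comp_mapCell, VFunctor.tensor_mapCell] at h

theorem obj_oid (F : V2Functor U W) (a : U.Obj) :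
    (F.map a a).obj (U.oid a) = W.oid (F.obj a) :=
  congrArg (fun G : VFunctor (VCat.unitCat k V) _ => G.obj PUnit.unit) (F.map_id a)

/-- Naturality of a family of 2-cells between the values of two `V`-2-functors. -/
def IsNatural (T S : V2Functor U W) (c : ∀ a, (W.hom (T.obj a) (S.obj a)).Cell (unit k)) : Prop :=
  ∀ (a b : U.Obj) (X : V) (x : (U.hom a b).Cell X),
    W.hcomp (unit_tensorObj _ X) (c b) ((T.map a b).mapCell x) =
      W.hcomp (tensorObj_unit _ X) ((S.map a b).mapCell x) (c a)

theorem IsNatural.congr {T S : V2Functor U W}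
    {c d : ∀ a, (W.hom (T.obj a) (S.obj a)).Cell (unit k)} (hc : IsNatural T S c)
    (h : ∀ a, c a = d a) : IsNatural T S d := by
  obtain rfl : c = d := funext h
  exact hc

theorem isNatural_idCell (T : V2Functor U W) :
    IsNatural T T fun a => VCat.Cell.idCell (W.oid (T.obj a)) := by
  intro a b X x
  rw [W.idCell_hcomp, W.hcomp_idCell]

/-- The usual pasting (d∗c)∗Tx = d∗(Sx∗c) = (Rx∗d)∗c. The element `x` of arbitrary shape passes
through all three positions, whence the three forms of associativity. -/
theorem IsNatural.hcomp {T S R : V2Functor U W}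
    {c : ∀ a, (W.hom (T.obj a) (S.obj a)).Cell (unit k)}
    {d : ∀ a, (W.hom (S.obj a) (R.obj a)).Cell (unit k)}
    (hd : IsNatural S R d) (hc : IsNatural T S c) :
    IsNatural T R fun a => W.hcomp (unit_tensorObj _ _) (d a) (c a) := by
  intro a b X x
  rw [W.hcomp_assoc_right, hc, ← W.hcomp_assoc_middle, hd, W.hcomp_assoc_left]

/-- The same pasting, where `G` applied to the naturality of `c` moves `x` past `G c`, and the
naturality of `d` at `F' x` moves it past `d`. -/
theorem IsNatural.whisker {F F' : V2Functor U W} {G G' : V2Functor W Y}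
    {c : ∀ a, (W.hom (F.obj a) (F'.obj a)).Cell (unit k)}
    {d : ∀ a, (Y.hom (G.obj a) (G'.obj a)).Cell (unit k)}
    (hd : IsNatural G G' d) (hc : IsNatural F F' c) :
    IsNatural (F.comp G) (F'.comp G') fun a =>
      Y.hcomp (unit_tensorObj _ _) (d (F'.obj a)) ((G.map _ _).mapCell (c a)) := by
  intro a b X x
  simp only [comp, VFunctor.comp_mapCell]
  rw [Y.hcomp_assoc_right, ← G.mapCell_hcomp, hc, G.mapCell_hcomp, ← Y.hcomp_assoc_middle, hd,
    Y.hcomp_assoc_left]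

/-- Factor `x` as x∘1. Then (d∘c)∗(Tx∘1) = (d∗Tx)∘(c∗1) = (Sx∗d)∘(1∗c) = (Sx∘1)∗(d∘c), by
interchange twice and the two naturalities. -/
theorem IsNatural.vcomp {T S : V2Functor U W}
    {c d : ∀ a, (W.hom (T.obj a) (S.obj a)).Cell (unit k)} (hd : IsNatural T S d)
    (hc : IsNatural T S c) (h : ∀ a, (c a).tgt = (d a).src) :
    IsNatural T S fun a => (d a).vcomp (unit_tensorObj _ _) (c a) (h a) := by
  intro a b X x
  have ht : ((T.map a b).mapCell (VCat.Cell.idCell x.src)).tgt = ((T.map a b).mapCell x).src := rfl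
  have hs : ((S.map a b).mapCell (VCat.Cell.idCell x.src)).tgt = ((S.map a b).mapCell x).src := rfl
  have e₁ : (T.map a b).mapCell x = ((T.map a b).mapCell x).vcomp (tensorObj_unit _ X)
      ((T.map a b).mapCell (VCat.Cell.idCell x.src)) ht := by
    rw [← VFunctor.mapCell_vcomp _ _ _ _ rfl, VCat.Cell.vcomp_idCell]
  have e₂ : (S.map a b).mapCell x = ((S.map a b).mapCell x).vcomp (tensorObj_unit _ X)
      ((S.map a b).mapCell (VCat.Cell.idCell x.src)) hs := by
    rw [← VFunctor.mapCell_vcomp _ _ _ _ rfl, VCat.Cell.vcomp_idCell]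
  refine (congrArg _ e₁).trans (Eq.trans ?_ (congrArg (fun y => W.hcomp _ y _) e₂).symm)
  -- Putting the identity on the right of `x` makes the last two arguments of η¹² equal to `I` in
  -- both interchanges, so the internal unit condition applies.
  refine (W.hcomp_vcomp _ _ _ (unit_tensorObj _ _) (unit_tensorObj _ X) (tensorObj_unit _ X) _
    (inter_unit_right _ _ _) _ _ _ _ (h b) ht ?_).trans (Eq.trans ?_ (W.hcomp_vcomp _ _ _
    (unit_tensorObj _ _) (tensorObj_unit _ X) (tensorObj_unit _ X) _
    (inter_unit_right _ _ _) _ _ _ _ hs (h a) ?_).symm)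
  · exact congrArg (W.comp _ _ _).obj (Prod.ext (h b) ht)
  · exact VCat.Cell.vcomp_congr _ (hd a b X x) (hc a b _ _) _

end V2Functor

/-! ### `V`-2-natural transformations as families of 1-cells. -/

namespace V2Nat

variable {U W : V2Cat.{w} k V} {T S : V2Functor U W}

theorem ext_of_cell {θ φ : V2Nat T S} (h : ∀ a, θ.cell a = φ.cell a) : θ = φ := by
  obtain ⟨f, _⟩ := θ
  obtain ⟨g, _⟩ := φ
  obtain rfl : f = g := funext fun a => VFunctor.ext_of_obj (h a)
  rfl

/-- The identity 2-cells of the components of a `V`-2-natural transformation are natural. -/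
theorem isNatural (θ : V2Nat T S) :
    V2Functor.IsNatural T S fun a => VCat.Cell.idCell (θ.cell a) := by
  intro a b X x
  have h := congrArg (fun F => VFunctor.mapCell F x) (θ.naturality a b)
  exact (VFunctor.leftUnitorInv_comp_mapCell _ _ _ x).symm.trans
    (h.trans (VFunctor.rightUnitorInv_comp_mapCell _ _ _ x))

/-- The `V`-2-natural transformation with given 1-cells. -/
def ofObj (o : ∀ a, (W.hom (T.obj a) (S.obj a)).Obj)
    (h : V2Functor.IsNatural T S fun a => VCat.Cell.idCell (o a)) : V2Nat T S where
  app a := VFunctor.point (o a)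
  naturality a b := by
    apply VFunctor.ext_of_mapCell
    intro f g
    exact (VFunctor.leftUnitorInv_comp_mapCell _ _ _ _).trans
      ((h a b _ _).trans (VFunctor.rightUnitorInv_comp_mapCell (VFunctor.point (o a)) (S.map a b)
        (W.comp _ _ _) _).symm)

/-- The identity `V`-2-natural transformation. -/
def id (T : V2Functor U W) : V2Nat T T :=
  ofObj (fun a => W.oid (T.obj a)) (V2Functor.isNatural_idCell T)

/-- The composite of two `V`-2-natural transformations, first `γ`, then `β`. -/
def comp {R : V2Functor U W} (γ : V2Nat T S) (β : V2Nat S R) : V2Nat T R :=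
  ofObj (fun a => W.ocomp (β.cell a) (γ.cell a)) 
    ((β.isNatural.hcomp γ.isNatural).congr fun _ => W.idCell_hcomp_idCell _ _)

/-- The composite along an object of two `V`-2-natural transformations, first `α`, then `γ`. -/
def whisker {Y : V2Cat.{w} k V} {F F' : V2Functor U W} {G G' : V2Functor W Y} (α : V2Nat F F')
    (γ : V2Nat G G') : V2Nat (F.comp G) (F'.comp G') :=
  ofObj (fun a => Y.ocomp (γ.cell (F'.obj a)) ((G.map _ _).obj (α.cell a))) 
    ((γ.isNatural.whisker α.isNatural).congr fun _ => by
      rw [VFunctor.mapCell_idCell]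
      exact Y.idCell_hcomp_idCell _ _)

end V2Nat

/-! ### `V`-modifications and their compositions. -/

namespace VModification

variable {U W : V2Cat.{w} k V} {T S : V2Functor U W} {θ φ : V2Nat T S}

/-- The component of a `V`-modification as a 2-cell. -/
def cell (μ : VModification θ φ) (a : U.Obj) : (W.hom (T.obj a) (S.obj a)).Cell (unit k) :=
  ⟨θ.cell a, φ.cell a, μ.app a⟩

theorem ext_of_app {μ ν : VModification θ φ} (h : ∀ a, μ.app a = ν.app a) : μ = ν := by
  obtain ⟨f, _⟩ := μ
  obtain ⟨g, _⟩ := ν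
  obtain rfl : f = g := funext h
  rfl

theorem naturality_iff
    (c : ∀ a, (unit k : V) ⟶ (W.hom (T.obj a) (S.obj a)).hom (θ.cell a) (φ.cell a))
    {a b : U.Obj} (f g : (U.hom a b).Obj) :
    (eqToHom (unit_tensorObj (two k) ((U.hom a b).hom f g)).symm ≫
        tensorHom (two k) (c b) ((T.map a b).map f g) ≫
        (W.comp (T.obj a) (T.obj b) (S.obj b)).map
          (θ.cell b, (T.map a b).obj f) (φ.cell b, (T.map a b).obj g) ≫
        eqToHom (by rw [θ.naturality_obj f, φ.naturality_obj g]) =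
      eqToHom (tensorObj_unit (two k) ((U.hom a b).hom f g)).symm ≫
        tensorHom (two k) ((S.map a b).map f g) (c a) ≫
        (W.comp (T.obj a) (S.obj a) (S.obj b)).map
          ((S.map a b).obj f, θ.cell a) ((S.map a b).obj g, φ.cell a)) ↔
    W.hcomp (unit_tensorObj _ _) ⟨θ.cell b, φ.cell b, c b⟩ ((T.map a b).mapCell ⟨f, g, 𝟙 _⟩) =
      W.hcomp (tensorObj_unit _ _) ((S.map a b).mapCell ⟨f, g, 𝟙 _⟩) ⟨θ.cell a, φ.cell a, c a⟩ := by
  have h := VCat.Cell.mk_eq_mk_iff (A := W.hom (T.obj a) (S.obj b)) (θ.naturality_obj f)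
    (φ.naturality_obj g)
    ((eqToHom (unit_tensorObj (two k) ((U.hom a b).hom f g)).symm ≫
        tensorHom (two k) (c b) ((T.map a b).map f g)) ≫
        (W.comp (T.obj a) (T.obj b) (S.obj b)).map
          (θ.cell b, (T.map a b).obj f) (φ.cell b, (T.map a b).obj g))
    ((eqToHom (tensorObj_unit (two k) ((U.hom a b).hom f g)).symm ≫
        tensorHom (two k) ((S.map a b).map f g) (c a)) ≫
        (W.comp (T.obj a) (S.obj a) (S.obj b)).map
          ((S.map a b).obj f, θ.cell a) ((S.map a b).obj g, φ.cell a))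
  rw [VFunctor.mapCell_id, VFunctor.mapCell_id]
  refine Iff.trans (Eq.to_iff ?_) h.symm
  have e : ∀ {P Q R M N : V} (p : P ⟶ Q) (q : Q ⟶ R) (r : R ⟶ M) (s : M ⟶ N) (t : P ⟶ N),
      (p ≫ q ≫ r ≫ s = t) = (((p ≫ q) ≫ r) ≫ s = t) := by simp
  exact (e _ _ _ _ _).trans (congrArg (_ = ·) (Category.assoc _ _ _).symm)

/-- The defining condition is naturality at generic elements; every `x` is the reindexing of a
generic element along `x.el`. -/
theorem isNatural (μ : VModification θ φ) : V2Functor.IsNatural T S μ.cell := by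
  intro a b X x
  have h := congrArg (VCat.Cell.precomp x.el) ((naturality_iff μ.app x.src x.tgt).1
    (μ.naturality a b x.src x.tgt))
  rw [← V2Cat.hcomp_precomp_left, ← V2Cat.hcomp_precomp_right, ← VFunctor.mapCell_precomp,
    ← VFunctor.mapCell_precomp] at h
  have e : VCat.Cell.precomp x.el ⟨x.src, x.tgt, 𝟙 _⟩ = x := by simp [VCat.Cell.precomp]
  rwa [e] at h

/-- The `V`-modification with given components. -/
def ofApp (c : ∀ a, (unit k : V) ⟶ (W.hom (T.obj a) (S.obj a)).hom (θ.cell a) (φ.cell a))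
    (h : V2Functor.IsNatural T S fun a => ⟨θ.cell a, φ.cell a, c a⟩) : VModification θ φ where
  app := c
  naturality a b f g := (naturality_iff c f g).2 (h a b _ _)

/-- The identity `V`-modification. -/
def id (θ : V2Nat T S) : VModification θ θ :=
  ofApp (fun a => (W.hom _ _).id (θ.cell a)) θ.isNatural

/-- The composite of two `V`-modifications along a `V`-2-natural transformation. -/
def comp {ψ : V2Nat T S} (μ : VModification θ φ) (ν : VModification φ ψ) : VModification θ ψ :=
  ofApp (fun a => (W.hom _ _).pointComp (ν.app a) (μ.app a)) 
    ((ν.isNatural.vcomp μ.isNatural fun _ => rfl).congr fun _ => VCat.Cell.vcomp_mk _ _ _ rfl)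

/-- The composite of two `V`-modifications along a `V`-2-functor. -/
def hcomp {R : V2Functor U W} {θ φ : V2Nat T S} {θ' φ' : V2Nat S R} (μ : VModification θ φ)
    (ν : VModification θ' φ') : VModification (θ.comp θ') (φ.comp φ') :=
  ofApp (fun a => W.pointComp (ν.app a) (μ.app a)) 
    ((ν.isNatural.hcomp μ.isNatural).congr fun _ => W.hcomp_mk _ _)

/-- The composite of two `V`-modifications along a `V`-2-category. -/
def whisker {Y : V2Cat.{w} k V} {F F' : V2Functor U W} {G G' : V2Functor W Y}
    {α α' : V2Nat F F'} {γ γ' : V2Nat G G'} (μ : VModification α α') (ν : VModification γ γ') :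
    VModification (α.whisker γ) (α'.whisker γ') :=
  ofApp (fun a => Y.pointComp (ν.app (F'.obj a))
      (μ.app a ≫ (G.map (F.obj a) (F'.obj a)).map (α.cell a) (α'.cell a))) 
    ((ν.isNatural.whisker μ.isNatural).congr fun _ => Y.hcomp_mk _ _)

theorem comp_cell {ψ : V2Nat T S} (μ : VModification θ φ) (ν : VModification φ ψ) (a : U.Obj) :
    (μ.comp ν).cell a = (ν.cell a).vcomp (unit_tensorObj _ _) (μ.cell a) rfl :=
  (VCat.Cell.vcomp_mk _ _ _ rfl).symm

theorem hcomp_cell {R : V2Functor U W} {θ φ : V2Nat T S} {θ' φ' : V2Nat S R}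
    (μ : VModification θ φ) (ν : VModification θ' φ') (a : U.Obj) :
    (μ.hcomp ν).cell a = W.hcomp (unit_tensorObj _ _) (ν.cell a) (μ.cell a) :=
  (W.hcomp_mk _ _).symm

theorem whisker_cell {Y : V2Cat.{w} k V} {F F' : V2Functor U W} {G G' : V2Functor W Y}
    {α α' : V2Nat F F'} {γ γ' : V2Nat G G'} (μ : VModification α α') (ν : VModification γ γ')
    (a : U.Obj) : (μ.whisker ν).cell a =
      Y.hcomp (unit_tensorObj _ _) (ν.cell (F'.obj a)) ((G.map _ _).mapCell (μ.cell a)) :=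
  (Y.hcomp_mk _ _).symm

/-- The two formulas for composition along a `V`-2-category agree because `ν` is natural with
respect to the 2-cell `μ.cell a`. -/
theorem whisker_cell' {Y : V2Cat.{w} k V} {F F' : V2Functor U W} {G G' : V2Functor W Y}
    {α α' : V2Nat F F'} {γ γ' : V2Nat G G'} (μ : VModification α α') (ν : VModification γ γ')
    (a : U.Obj) : (μ.whisker ν).cell a =
      Y.hcomp (unit_tensorObj _ _) ((G'.map _ _).mapCell (μ.cell a)) (ν.cell (F.obj a)) :=
  (whisker_cell μ ν a).trans (ν.isNatural _ _ _ _)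

theorem ext_of_cell {μ ν : VModification θ φ} (h : ∀ a, μ.cell a = ν.cell a) : μ = ν :=
  ext_of_app fun a => eq_of_heq (VCat.Cell.heq_el (h a))

theorem heq_of_cell {T' S' : V2Functor U W} (hT : T = T') (hS : S = S') {θ' φ' : V2Nat T' S'}
    {μ : VModification θ φ} {ν : VModification θ' φ'}
    (h : ∀ a, HEq (μ.cell a) (ν.cell a)) : HEq μ ν := by
  subst hT hS
  obtain rfl : θ = θ' := V2Nat.ext_of_cell fun a => congrArg VCat.Cell.src (eq_of_heq (h a))
  obtain rfl : φ = φ' := V2Nat.ext_of_cell fun a => congrArg VCat.Cell.tgt (eq_of_heq (h a))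
  exact heq_of_eq (ext_of_cell fun a => eq_of_heq (h a))

/-- The category of `V`-2-natural transformations and `V`-modifications. -/
@[reducible] def categoryOn (T S : V2Functor U W) :
    CategoryOn (fun θ φ : V2Nat T S => VModification θ φ) where
  id := id
  comp := comp
  -- `comp` is in diagrammatic order and `pointComp` is not, so left and right unit laws are
  -- exchanged.
  id_comp μ := ext_of_app fun a => (W.hom _ _).pointComp_id _
  comp_id μ := ext_of_app fun a => (W.hom _ _).id_pointComp _
  assoc μ ν ξ := ext_of_app fun a => ((W.hom _ _).pointComp_assoc _ _ _).symm

instance (T S : V2Functor U W) : Category (V2Nat T S) := (categoryOn T S).toCategory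

end VModification

theorem V2Cat.hcomp_vcomp_unit (W : V2Cat.{w} k V) {a b c : W.Obj}
    (y' y : (W.hom b c).Cell (unit k)) (x' x : (W.hom a b).Cell (unit k)) (hy : y.tgt = y'.src)
    (hx : x.tgt = x'.src) (h : (W.hcomp (unit_tensorObj _ _) y x).tgt =
      (W.hcomp (unit_tensorObj _ _) y' x').src) :
    W.hcomp (unit_tensorObj _ _) (y'.vcomp (unit_tensorObj _ _) y hy)
        (x'.vcomp (unit_tensorObj _ _) x hx) =
      (W.hcomp (unit_tensorObj _ _) y' x').vcomp (unit_tensorObj _ _)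
        (W.hcomp (unit_tensorObj _ _) y x) h :=
  W.hcomp_vcomp _ _ _ _ _ _ _ (inter_unit_right _ _ _) _ _ _ _ hy hx h

/-! ### The 2-category of `V`-2-functors between two `V`-2-categories. -/

namespace VModification

variable {U W Y : V2Cat.{w} k V} {T S R : V2Functor U W}

theorem id_cell (θ : V2Nat T S) (a : U.Obj) : (id θ).cell a = VCat.Cell.idCell (θ.cell a) := rfl

theorem id_hcomp_id (θ : V2Nat T S) (φ : V2Nat S R) : (id θ).hcomp (id φ) = id (θ.comp φ) :=
  ext_of_cell fun a => (hcomp_cell _ _ a).trans (W.idCell_hcomp_idCell _ _)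

theorem id_whisker_id {F F' : V2Functor U W} {G G' : V2Functor W Y} (α : V2Nat F F')
    (γ : V2Nat G G') : (id α).whisker (id γ) = id (α.whisker γ) :=
  ext_of_cell fun a => (whisker_cell _ _ a).trans (by
    rw [id_cell, id_cell, VFunctor.mapCell_idCell]
    exact Y.idCell_hcomp_idCell _ _)

theorem comp_hcomp_comp {θ φ ψ : V2Nat T S} {θ' φ' ψ' : V2Nat S R} (μ : VModification θ φ)
    (ν : VModification φ ψ) (μ' : VModification θ' φ') (ν' : VModification φ' ψ') :
    (μ.comp ν).hcomp (μ'.comp ν') = (μ.hcomp μ').comp (ν.hcomp ν') := by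
  refine ext_of_cell fun a => (hcomp_cell _ _ a).trans ?_
  rw [comp_cell, comp_cell, comp_cell]
  refine (W.hcomp_vcomp_unit _ _ _ _ rfl rfl rfl).trans ?_
  exact VCat.Cell.vcomp_congr _ (hcomp_cell _ _ a).symm (hcomp_cell _ _ a).symm _

/-- `G` preserves vertical composites, after which this is interchange at elements of shape `I`. -/
theorem comp_whisker_comp {F F' : V2Functor U W} {G G' : V2Functor W Y} {α α' α'' : V2Nat F F'}
    {γ γ' γ'' : V2Nat G G'} (μ : VModification α α') (μ' : VModification α' α'')
    (ν : VModification γ γ') (ν' : VModification γ' γ'') :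
    (μ.comp μ').whisker (ν.comp ν') = (μ.whisker ν).comp (μ'.whisker ν') := by
  refine ext_of_cell fun a => (whisker_cell _ _ a).trans ?_
  rw [comp_cell, comp_cell, comp_cell]
  refine (congrArg (Y.hcomp _ _) (VFunctor.mapCell_vcomp _ _ _ _ _)).trans ?_
  refine (Y.hcomp_vcomp_unit _ _ _ _ rfl rfl rfl).trans ?_
  exact VCat.Cell.vcomp_congr _ (whisker_cell _ _ a).symm (whisker_cell _ _ a).symm _

/-- Composition along a `V`-2-functor. -/
def hcompFunctor (T S R : V2Functor U W) : V2Nat T S × V2Nat S R ⥤ V2Nat T R where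
  obj p := p.1.comp p.2
  map f := hcomp f.1 f.2
  map_id p := id_hcomp_id p.1 p.2
  map_comp f g := comp_hcomp_comp f.1 g.1 f.2 g.2

/-- Composition along a `V`-2-category. -/
def whiskerFunctor (F F' : V2Functor U W) (G G' : V2Functor W Y) :
    V2Nat F F' × V2Nat G G' ⥤ V2Nat (F.comp G) (F'.comp G') where
  obj p := p.1.whisker p.2
  map f := whisker f.1 f.2
  map_id p := id_whisker_id p.1 p.2
  map_comp f g := comp_whisker_comp f.1 g.1 f.2 g.2

theorem id_hcomp {θ φ : V2Nat T S} (μ : VModification θ φ) (a : U.Obj) :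
    ((id (V2Nat.id T)).hcomp μ).cell a = μ.cell a :=
  (hcomp_cell _ _ a).trans (W.hcomp_idCell _)

theorem hcomp_id {θ φ : V2Nat T S} (μ : VModification θ φ) (a : U.Obj) :
    (μ.hcomp (id (V2Nat.id S))).cell a = μ.cell a :=
  (hcomp_cell _ _ a).trans (W.idCell_hcomp _)

theorem hcomp_assoc {Q : V2Functor U W} {θ φ : V2Nat T S} {θ' φ' : V2Nat S R} {θ'' φ'' : V2Nat R Q}
    (μ : VModification θ φ) (ν : VModification θ' φ') (ξ : VModification θ'' φ'') (a : U.Obj) :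
    ((μ.hcomp ν).hcomp ξ).cell a = (μ.hcomp (ν.hcomp ξ)).cell a := by
  rw [hcomp_cell, hcomp_cell, hcomp_cell, hcomp_cell, W.hcomp_assoc_right]

theorem functor_ext {C : Type*} [Category C] {F G : C ⥤ V2Nat T S}
    (h : ∀ {x y : C} (f : x ⟶ y) (a : U.Obj),
      cell (F.map f) a = cell (G.map f) a) : F = G := by
  -- The value at an object is recovered as the source of the image of its identity.
  have ho : ∀ x, F.obj x = G.obj x := fun x =>
    V2Nat.ext_of_cell fun a => congrArg VCat.Cell.src (h (𝟙 x) a)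
  exact Functor.hext ho fun x y f => heq_of_cell rfl rfl fun a => heq_of_eq (h f a)

/-- The 2-category of `V`-2-functors, `V`-2-natural transformations and `V`-modifications. -/
def twoCatOn (U W : V2Cat.{w} k V) :
    EnrichedCategoryOn fun T S : V2Functor U W => (categoryOn T S).toCat where
  id T := (Cat.fromChosenTerminalEquiv.symm (V2Nat.id T)).toCatHom
  comp T S R := (hcompFunctor T S R).toCatHom
  id_comp T S := Cat.Hom.ext (functor_ext fun μ a => id_hcomp μ a)
  comp_id T S := Cat.Hom.ext (functor_ext fun μ a => hcomp_id μ a)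
  assoc T S R Q := Cat.Hom.ext (functor_ext fun μ a => hcomp_assoc μ.1 μ.2.1 μ.2.2 a)

/-- Unit and associativity laws for `V`-2-functors are only propositional, so the functors compared
in the outer axioms have different codomains until these laws are substituted. -/
theorem cat_heq {A : Cat} {T T' S S' : V2Functor U W} (hT : T = T') (hS : S = S')
    {F : A ⟶ (categoryOn T S).toCat} {G : A ⟶ (categoryOn T' S').toCat}
    (h : ∀ {x y : A} (f : x ⟶ y) (a : U.Obj),
      HEq (cell (F.toFunctor.map f) a) (cell (G.toFunctor.map f) a)) : HEq F G := by
  subst hT hS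
  exact heq_of_eq (Cat.Hom.ext (functor_ext fun f a => eq_of_heq (h f a)))

end VModification

namespace V2Functor

theorem comp_assoc {U W X Y : V2Cat.{w} k V} (F : V2Functor U W) (G : V2Functor W X)
    (H : V2Functor X Y) : (F.comp G).comp H = F.comp (G.comp H) := by
  simp only [comp, VFunctor.comp_assoc]

theorem id_comp {U W : V2Cat.{w} k V} (F : V2Functor U W) : (id U).comp F = F := by
  obtain ⟨o, f, _, _⟩ := F
  simp only [comp, id, VFunctor.id_comp]

theorem comp_id {U W : V2Cat.{w} k V} (F : V2Functor U W) : F.comp (id W) = F := by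
  obtain ⟨o, f, _, _⟩ := F
  simp only [comp, id, VFunctor.comp_id]

end V2Functor

/-! ### Composition along a `V`-2-category and the 3-category axioms. -/

namespace VModification

variable {U W X Y : V2Cat.{w} k V}

theorem id_whisker_id_cell (F : V2Functor U W) (G : V2Functor W X) (a : U.Obj) :
    ((id (V2Nat.id F)).whisker (id (V2Nat.id G))).cell a = (id (V2Nat.id (F.comp G))).cell a := by
  refine (whisker_cell _ _ a).trans ((X.idCell_hcomp _).trans ?_)
  refine (VFunctor.mapCell_idCell _ _).trans ?_
  exact congrArg VCat.Cell.idCell (G.obj_oid (F.obj a))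

/-- After reassociation the two sides differ only in the middle, ν∗Gμ' against G'μ'∗ν; naturality of
`ν` at the 2-cell of `μ'` exchanges them. -/
theorem hcomp_whisker_hcomp {F F' F'' : V2Functor U W} {G G' G'' : V2Functor W X}
    {α β : V2Nat F F'} {α' β' : V2Nat F' F''} {γ δ : V2Nat G G'} {γ' δ' : V2Nat G' G''}
    (μ : VModification α β) (μ' : VModification α' β') (ν : VModification γ δ)
    (ν' : VModification γ' δ') (a : U.Obj) :
    ((μ.hcomp μ').whisker (ν.hcomp ν')).cell a =
      ((μ.whisker ν).hcomp (μ'.whisker ν')).cell a := by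
  refine (whisker_cell _ _ a).trans (Eq.trans ?_ (hcomp_cell _ _ a).symm)
  rw [hcomp_cell, hcomp_cell, V2Functor.mapCell_hcomp]
  refine Eq.trans ?_ (congrArg₂ (X.hcomp _) (whisker_cell _ _ a) (whisker_cell _ _ a)).symm
  have h := ν.isNatural _ _ _ (μ'.cell a)
  rw [X.hcomp_assoc_right]
  refine Eq.trans ?_ (X.hcomp_assoc_right _ _ _).symm
  refine congrArg (X.hcomp _ _) ?_
  refine (X.hcomp_assoc_right _ _ _).symm.trans (Eq.trans ?_ (X.hcomp_assoc_right _ _ _))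
  exact congrArg (fun c => X.hcomp _ c _) h

theorem id_whisker {F F' : V2Functor U W} {α β : V2Nat F F'} (μ : VModification α β) (a : U.Obj) :
    ((id (V2Nat.id (V2Functor.id U))).whisker μ).cell a = μ.cell a := by
  refine (whisker_cell' _ _ a).trans ?_
  refine Eq.trans (congrArg (fun c => W.hcomp _ c _) ?_) (W.idCell_hcomp _)
  exact (VFunctor.mapCell_idCell _ _).trans (congrArg VCat.Cell.idCell (F'.obj_oid a))

theorem whisker_id {F F' : V2Functor U W} {α β : V2Nat F F'} (μ : VModification α β) (a : U.Obj) :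
    (μ.whisker (id (V2Nat.id (V2Functor.id W)))).cell a = μ.cell a :=
  (whisker_cell _ _ a).trans ((W.idCell_hcomp _).trans (VFunctor.id_mapCell _))

/-- Both sides are bracketings of ξ∗Hν∗HGμ, since `H` preserves horizontal composites. -/
theorem whisker_assoc {F F' : V2Functor U W} {G G' : V2Functor W X} {H H' : V2Functor X Y}
    {α β : V2Nat F F'} {α' β' : V2Nat G G'} {α'' β'' : V2Nat H H'}
    (μ : VModification α β) (ν : VModification α' β') (ξ : VModification α'' β'') (a : U.Obj) :
    ((μ.whisker ν).whisker ξ).cell a = (μ.whisker (ν.whisker ξ)).cell a := by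
  refine (whisker_cell (μ.whisker ν) ξ a).trans
    (Eq.trans ?_ (whisker_cell μ (ν.whisker ξ) a).symm)
  refine (congrArg (fun c => Y.hcomp _ _ (VFunctor.mapCell _ c)) (whisker_cell _ _ a)).trans ?_
  refine Eq.trans ?_ (congrArg (fun c => Y.hcomp (unit_tensorObj _ _) c
    (((G.comp H).map _ _).mapCell (μ.cell a))) (whisker_cell ν ξ (F'.obj a))).symm
  refine (congrArg _ (H.mapCell_hcomp _ _ _)).trans ?_
  refine (Y.hcomp_assoc_right _ _ _).symm.trans ?_
  exact congrArg _ (VFunctor.comp_mapCell _ _ _).symm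

open MonoidalCategory in
/-- Composition along a `V`-2-category, as a morphism of `Cat`. -/
def whiskerCat (F F' : V2Functor U W) (G G' : V2Functor W X) :
    (categoryOn F F').toCat ⊗ (categoryOn G G').toCat ⟶
      (categoryOn (F.comp G) (F'.comp G')).toCat :=
  (whiskerFunctor F F' G G').toCatHom

open MonoidalCategory in
/-- Composition of `V`-2-functors as a 2-functor. -/
def compTwoFunctor (U W X : V2Cat.{w} k V) :
    (twoCatOn U W).toTwoCat ⊗ (twoCatOn W X).toTwoCat ⟶ (twoCatOn U X).toTwoCat where
  obj p := p.1.comp p.2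
  map p q := whiskerCat p.1 q.1 p.2 q.2
  map_id p := Cat.Hom.ext (functor_ext fun f a => id_whisker_id_cell p.1 p.2 a)
  map_comp p q r := Cat.Hom.ext (functor_ext fun f a =>
    hcomp_whisker_hcomp f.1.1 f.2.1 f.1.2 f.2.2 a)

open MonoidalCategory in
/-- The identity `V`-2-functor as a 2-functor. -/
def idTwoFunctor (U : V2Cat.{w} k V) : 𝟙_ TwoCat ⟶ (twoCatOn U U).toTwoCat where
  obj _ := V2Functor.id U
  map _ _ := (twoCatOn U U).id (V2Functor.id U)
  map_id _ := Category.id_comp _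
  -- The source has one 2-cell and one 3-cell, so all that is needed is 1∗1 = 1 for the identity
  -- modification.
  map_comp _ _ _ := Cat.Hom.ext (functor_ext fun f a => (id_hcomp (id (V2Nat.id _)) a).symm)

/-- The 3-category of `V`-2-categories. -/
def threeCategoryOn (k : ℕ) [Fact (2 ≤ k)] (V : Type u) [Category.{v} V] [IteratedMonoidal k V] :
    ThreeCategoryOn (C := V2Cat.{w} k V) V2Functor V2Nat VModification where
  homCat := categoryOn
  homTwoCat := twoCatOn
  enriched :=
    { id := idTwoFunctor
      comp := compTwoFunctor
      id_comp := fun U W => EnrichedFunctor.ext _ (fun F => V2Functor.id_comp F) fun F G =>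
        eq_of_heq ((comp_eqToHom_heq _ _).trans (cat_heq (V2Functor.id_comp F)
          (V2Functor.id_comp G) fun μ a => heq_of_eq (id_whisker μ a)))
      comp_id := fun U W => EnrichedFunctor.ext _ (fun F => V2Functor.comp_id F) fun F G =>
        eq_of_heq ((comp_eqToHom_heq _ _).trans (cat_heq (V2Functor.comp_id F)
          (V2Functor.comp_id G) fun μ a => heq_of_eq (whisker_id μ a)))
      assoc := fun U W X Y => EnrichedFunctor.ext _
        (fun F => V2Functor.comp_assoc F.1 F.2.1 F.2.2) fun F G =>
        eq_of_heq ((comp_eqToHom_heq _ _).trans (cat_heq (V2Functor.comp_assoc F.1 F.2.1 F.2.2)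
          (V2Functor.comp_assoc G.1 G.2.1 G.2.2)
          fun μ a => heq_of_eq (whisker_assoc μ.1 μ.2.1 μ.2.2 a))) }

end VModification

end

/-! ### The theorem, with the formulas for the compositions. -/

theorem mainTheorem1 (k : ℕ) [Fact (2 ≤ k)] (V : Type u) [Category.{v} V]
    [IteratedMonoidal k V] :
    ∃ S : ThreeCategoryOn (C := V2Cat.{w} k V) V2Functor V2Nat VModification,
      -- composition of `V`-modifications along a `V`-2-natural transformation, and its units
      (∀ {U W : V2Cat.{w} k V} {F G : V2Functor U W} {α β γ : V2Nat F G}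
        (μ : VModification α β) (ν : VModification β γ) (x : U.Obj),
        (S.vert μ ν).app x = (W.hom (F.obj x) (G.obj x)).pointComp (ν.app x) (μ.app x)) ∧
      (∀ {U W : V2Cat.{w} k V} {F G : V2Functor U W} (α : V2Nat F G) (x : U.Obj),
        (S.id₃ α).app x = (W.hom (F.obj x) (G.obj x)).id (α.cell x)) ∧
      -- composition along a `V`-2-functor, and its units
      (∀ {U W : V2Cat.{w} k V} {F G H : V2Functor U W} (γ : V2Nat F G) (β : V2Nat G H)
        (x : U.Obj), (S.hor₂ γ β).app x = W.cellComp (β.app x) (γ.app x)) ∧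
      (∀ {U W : V2Cat.{w} k V} {F G H : V2Functor U W} {γ γ' : V2Nat F G} {β β' : V2Nat G H}
        (μ : VModification γ γ') (ν : VModification β β') (x : U.Obj),
        HEq ((S.hor₃ μ ν).app x) (W.pointComp (ν.app x) (μ.app x))) ∧
      (∀ {U W : V2Cat.{w} k V} (F : V2Functor U W) (x : U.Obj),
        (S.id₂ F).app x = W.id (F.obj x)) ∧
      -- composition along a `V`-2-category, and its units
      (∀ {U W X : V2Cat.{w} k V} (F : V2Functor U W) (G : V2Functor W X),
        S.comp₁ F G = F.comp G) ∧
      (∀ {U W X : V2Cat.{w} k V} {F F' : V2Functor U W} {G G' : V2Functor W X}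
        (α : V2Nat F F') (γ : V2Nat G G') (x : U.Obj),
        HEq ((S.comp₂ α γ).app x)
            (X.cellComp (γ.app (F'.obj x)) ((α.app x).comp (G.map (F.obj x) (F'.obj x)))) ∧
          HEq ((S.comp₂ α γ).app x)
            (X.cellComp ((α.app x).comp (G'.map (F.obj x) (F'.obj x))) (γ.app (F.obj x)))) ∧
      (∀ {U W X : V2Cat.{w} k V} {F F' : V2Functor U W} {G G' : V2Functor W X}
        {α α' : V2Nat F F'} {γ γ' : V2Nat G G'} (μ : VModification α α')
        (ν : VModification γ γ') (x : U.Obj),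
        HEq ((S.comp₃ μ ν).app x)
            (X.pointComp (ν.app (F'.obj x))
              (μ.app x ≫ (G.map (F.obj x) (F'.obj x)).map (α.cell x) (α'.cell x))) ∧
          HEq ((S.comp₃ μ ν).app x)
            (X.pointComp (μ.app x ≫ (G'.map (F.obj x) (F'.obj x)).map (α.cell x) (α'.cell x))
              (ν.app (F.obj x)))) ∧
      (∀ U : V2Cat.{w} k V, S.id₁ U = V2Functor.id U) := by
  refine ⟨VModification.threeCategoryOn k V, fun _ _ _ => rfl, fun _ _ => rfl,
    fun γ β x => VFunctor.ext_of_obj rfl, fun _ _ _ => HEq.rfl,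
    fun F x => VFunctor.ext_of_obj rfl, fun _ _ => rfl,
    fun α γ x => ⟨heq_of_eq (VFunctor.ext_of_obj rfl),
      -- The first formula has the chosen 1-cell by definition; the second has the 1-cell on the
      -- other side of the naturality square of `γ` at the 1-cell of `α`.
      heq_of_eq (VFunctor.ext_of_obj (γ.naturality_obj (α.cell x)))⟩,
    fun μ ν x => ⟨HEq.rfl, ?_⟩, fun _ => rfl⟩
  exact VCat.Cell.heq_el ((VModification.whisker_cell' μ ν x).trans (V2Cat.hcomp_mk _ _ _))
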